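/- Let $\mathcal H$ be a complex Hilbert space (inner product $\langle\cdot,\cdot\rangle$ linear in the first variable), $\mathcal L(\mathcal H)$ its bounded operators, $Z$ a Hausdorff space with its Borel $\sigma$-algebra. Let $K:Z\times Z\to\mathcal L(\mathcal H)$ be a positive semidefinite kernel, i.e. $\sum_{\mu,\nu}\langle K(x_\mu,x_\nu)v_\nu,v_\mu\rangle\ge 0$ for all finitely many distinct $x_\mu\in Z$ and all $v_\mu\in\mathcal H$, and let $\mathcal H_K$ be its reproducing kernel Hilbert space: the completion, realized as a space of functions $Z\to\mathcal H$, of the span of the functions $K_xv: z\mapsto K(z,x)v$ with inner product determined by $\langle K_xv,K_yu\rangle_{\mathcal H_K}=\langle v,K(x,y)u\rangle$. $K$ is called universal if $\mathcal H_K\subset C(Z,\mathcal H)$ and, for every compact $\mathcal A\subset Z$, every $g\in C(\mathcal A,\mathcal H)$ and every $\varepsilon>0$, there is $f\in\mathcal H_K$ with $\|f(x)-g(x)\|<\varepsilon$ for all $x\in\mathcal A$. For $Z$ locally compact, $K$ is called $C_0$-universal if $\mathcal H_K\subset C_0(Z,\mathcal H)$ and, for every $g\in C_0(Z,\mathcal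 H)$ and $\varepsilon>0$, there is $f\in\mathcal H_K$ with $\|f(x)-g(x)\|<\varepsilon$ for all $x\in Z$. Let $\mathfrak M(Z,\mathcal H)$ be the set of countably additive $\eta:\mathscr B(Z)\to\mathcal H$ of bounded variation whose variation $|\eta|$ is outer regular on Borel sets and inner regular by compact sets on open sets; the support of $\eta$ is that of $|\eta|$. For $F:Z\to\mathcal H$ Bochner integrable with respect to $|\eta|$, $\int_Z\langle F(x),d\eta(x)\rangle$ is the continuous extension of $\sum_i\langle v_i,\eta(A_i)\rangle$ from simple functions $\sum_i v_i\chi_{A_i}$. A function $T:Z\to\mathcal L(\mathcal H)$ is weak-Bochner integrable with respect to $\eta$ if every $Tv$, $v\in\mathcal H$, is Bochner integrable with respect to $|\eta|$ and $v\mapsto\int_Z\langle T(x)v,d\eta(x)\rangle$ is continuous; then $\int_Z T\,d\eta\in\mathcal H$ is the unique vector with $\langle v,\int_Z T\,d\eta\rangle=\int_Z\langle T(x)v,d\eta(x)\rangle$ for all $v\in\mathcal H$. **Theorem.** Suppose that $Z$ is locally compact and $\mathcal H_K\subset C_0(Z,\mathcal H)$ (respectively, that $\mathcal H_K\subset C(Z,\mathcal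 H)$). Then: (i) For every $\eta\in\mathfrak M(Z,\mathcal H)$ (respectively, every $\eta\in\mathfrak M(Z,\mathcal H)$ of compact support) and every $y\in Z$, the function $x\mapsto K(x,y)$ is weak-Bochner integrable with respect to $\eta$, and the function $K_\eta:Z\to\mathcal H$, $K_\eta(y)=\int_Z K(x,y)\,d\eta(x)$, that is, $\langle v,K_\eta(y)\rangle=\int_Z\langle K(x,y)v,d\eta(x)\rangle$ for all $v\in\mathcal H$, is an element of $\mathcal H_K$. (ii) For these $\eta$, the function $K_\eta$ is Bochner integrable with respect to $|\eta|$ and $$\langle K_\eta,K_\eta\rangle_{\mathcal H_K}=\int_Z\Big\langle\int_Z K(x,y)\,d\eta(x),\,d\eta(y)\Big\rangle .$$ If $d\eta=H\,d|\eta|$ is a Radon–Nikodým decomposition of $\eta$ (that is, $H$ is Bochner integrable with respect to $|\eta|$ and $\eta(A)=\int_A H\,d|\eta|$ for all Borel $A$), then $$\langle K_\eta,K_\eta\rangle_{\mathcal H_K}=\int_Z\int_Z\langle K(x,y)H(y),H(x)\rangle\,d|\eta|(x)\,d|\eta|(y),$$ where the inner integrand and then the inner integral are integrable with respect to $|\eta|$.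 (iii) $K$ is $C_0$-universal (respectively, universal) if and only if $\langle K_\eta,K_\eta\rangle_{\mathcal H_K}>0$ for every nonzero $\eta\in\mathfrak M(Z,\mathcal H)$ (respectively, every nonzero $\eta\in\mathfrak M(Z,\mathcal H)$ of compact support). -/

import Mathlib

open MeasureTheory Topology Filter
open scoped ComplexOrder

/-! Throughout, `E` is a complex Hilbert space. Mathlib's `inner ℂ a b` is linear in `b`, so the
product `⟨a, b⟩` that is linear in the first variable is `inner ℂ b a`. -/

namespace OpKernel

section Integrals

variable {Z E : Type*} [MeasurableSpace Z] [NormedAddCommGroup E] [InnerProductSpace ℂ E]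

/-- The pairing `(a, b) ↦ ⟨a, b⟩`, complex linear in `a` and conjugate linear in `b`, as a
continuous real bilinear map. -/
noncomputable def pairing (E : Type*) [NormedAddCommGroup E] [InnerProductSpace ℂ E] :
    E →L[ℝ] E →L[ℝ] ℂ :=
  (isBoundedBilinearMap_inner (𝕜 := ℂ) (E := E)).toContinuousLinearMap.flip

theorem pairing_apply (a b : E) : pairing E a b = inner ℂ b a := rfl

/-- The integral `∫ ⟨F(x), dη(x)⟩` of a vector valued function against a vector valued measure:
the extension of `∑ i, ⟨vᵢ, η(Aᵢ)⟩` from simple functions to the functions that are Bochner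
integrable with respect to the variation `|η|`. -/
noncomputable def bartleIntegral (η : VectorMeasure Z E) (F : Z → E) : ℂ :=
  η.integral F (pairing E)

/-- `η` has bounded variation, and its variation `|η|` is outer regular on Borel sets and inner
regular on open sets with respect to compact sets. -/
structure IsRadonBV [TopologicalSpace Z] (η : VectorMeasure Z E) : Prop where
  finite : IsFiniteMeasure η.variation
  regular : η.variation.Regular

/-- The support of `η`, i.e. of `|η|`, is compact. -/
def HasCompactSupp [TopologicalSpace Z] (η : VectorMeasure Z E) : Prop :=
  IsCompact η.variation.support

/-- `dη = h d|η|` is a Radon–Nikodým decomposition of `η`. -/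
structure IsRadonNikodymDensity (η : VectorMeasure Z E) (h : Z → E) : Prop where
  integrable : Integrable h η.variation
  apply_eq : ∀ A : Set Z, MeasurableSet A → η A = ∫ x in A, h x ∂η.variation

/-- `T` is weak-Bochner integrable with respect to `η`: every `T v` is Bochner integrable with
respect to `|η|`, and the functional `v ↦ ∫ ⟨T(x) v, dη(x)⟩` is continuous. -/
structure IsWeakBochnerIntegrable (η : VectorMeasure Z E) (T : Z → E →L[ℂ] E) : Prop where
  integrable : ∀ v : E, Integrable (fun x => T x v) η.variation
  continuous : Continuous fun v : E => bartleIntegral η (fun x => T x v)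

theorem bartleIntegral_add (η : VectorMeasure Z E) {F G : Z → E}
    (hF : Integrable F η.variation) (hG : Integrable G η.variation) :
    bartleIntegral η (fun x => F x + G x) = bartleIntegral η F + bartleIntegral η G :=
  VectorMeasure.integral_fun_add hF hG

theorem bartleIntegral_smul (η : VectorMeasure Z E) (c : ℂ) (F : Z → E) :
    bartleIntegral η (fun x => c • F x) = c * bartleIntegral η F := by
  refine setToFun_smul (𝕜 := ℂ) _ (fun c s x => ?_) c F
  rw [transpose_eq_cbmApplyMeasure, cbmApplyMeasure_apply, cbmApplyMeasure_apply,
    pairing_apply, pairing_apply, inner_smul_right, smul_eq_mul]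

/-- The continuous linear functional `v ↦ ∫ ⟨T(x) v, dη(x)⟩`. -/
noncomputable def weakBochnerFunctional {η : VectorMeasure Z E} {T : Z → E →L[ℂ] E}
    (h : IsWeakBochnerIntegrable η T) : E →L[ℂ] ℂ where
  toFun v := bartleIntegral η (fun x => T x v)
  map_add' u v := by
    simp only [map_add]
    exact bartleIntegral_add η (h.integrable u) (h.integrable v)
  map_smul' c v := by
    simp only [map_smul]
    exact bartleIntegral_smul η c _
  cont := h.continuous

open Classical in
/-- The weak-Bochner integral `∫ T(x) dη(x)`: the Riesz representative `w` of the functional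
`v ↦ ∫ ⟨T(x) v, dη(x)⟩ = ⟨v, w⟩` (and `0` if `T` is not weak-Bochner integrable). -/
noncomputable def weakBochnerIntegral [CompleteSpace E] (η : VectorMeasure Z E)
    (T : Z → E →L[ℂ] E) : E :=
  if h : IsWeakBochnerIntegrable η T then
    (InnerProductSpace.toDual ℂ E).symm (weakBochnerFunctional h)
  else 0

theorem inner_weakBochnerIntegral [CompleteSpace E] {η : VectorMeasure Z E} {T : Z → E →L[ℂ] E}
    (h : IsWeakBochnerIntegrable η T) (v : E) :
    inner ℂ (weakBochnerIntegral η T) v = bartleIntegral η (fun x => T x v) := by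
  rw [weakBochnerIntegral, dif_pos h, InnerProductSpace.toDual_symm_apply]
  rfl

end Integrals

section Kernels

variable {Z E : Type*} [NormedAddCommGroup E] [InnerProductSpace ℂ E]

/-- `K` is a positive semidefinite operator valued kernel: for distinct points `x₁, …, xₙ` and
vectors `v₁, …, vₙ` the sum `∑ μ, ∑ ν, ⟨K(x_μ, x_ν) v_ν, v_μ⟩` is real and nonnegative. -/
def IsPosSemidefKernel (K : Z → Z → E →L[ℂ] E) : Prop :=
  ∀ (n : ℕ) (x : Fin n → Z) (v : Fin n → E), Function.Injective x →
    0 ≤ ∑ μ, ∑ ν, inner ℂ (v μ) (K (x μ) (x ν) (v ν))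

theorem IsPosSemidefKernel.inner_comm {K : Z → Z → E →L[ℂ] E} (hK : IsPosSemidefKernel K)
    (x y : Z) (u v : E) : inner ℂ u (K x y v) = inner ℂ (K y x u) v := by
  have h1 : ∀ (x : Z) (u : E), (inner ℂ u (K x x u)).im = 0 := fun x u => by
    have := hK 1 (fun _ => x) (fun _ => u) (fun a b _ => Subsingleton.elim a b)
    simp only [Fin.sum_univ_one] at this
    exact (Complex.le_def.mp this).2.symm
  have h2 : ∀ u v : E, (inner ℂ u (K x y v)).im + (inner ℂ v (K y x u)).im = 0 := by
    intro u v
    rcases eq_or_ne x y with rfl | hxy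
    · have h3 := h1 x (u + v)
      simp only [map_add, inner_add_left, inner_add_right, Complex.add_im, h1] at h3
      linarith
    · have h3 := hK 2 ![x, y] ![u, v] (by
        intro a b hab
        fin_cases a <;> fin_cases b <;> simp_all [eq_comm])
      have h4 := (Complex.le_def.mp h3).2
      simp [Fin.sum_univ_two, h1] at h4
      linarith
  rw [← inner_conj_symm (K y x u) v]
  have h3 := h2 u v
  have h4 := h2 u (Complex.I • v)
  simp only [map_smul, inner_smul_left, inner_smul_right, Complex.conj_I] at h4
  simp at h4
  apply Complex.ext
  · simp only [Complex.conj_re]; linarith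
  · simp only [Complex.conj_im]; linarith

/-- A positive semidefinite kernel is a positive semidefinite (operator valued) matrix. -/
theorem IsPosSemidefKernel.posSemidef [CompleteSpace E] {K : Z → Z → E →L[ℂ] E}
    (hK : IsPosSemidefKernel K) : (Matrix.of K).PosSemidef := by
  have key : (Matrix.of K).IsHermitian ∧ ∀ f : Z →₀ E, 0 ≤ RCLike.re
      (f.sum fun x w => f.sum fun x' w' => inner ℂ (Matrix.of K x' x w) w') := ?_
  · exact (RKHS.posSemidef_tfae.out 0 2).mpr key
  refine ⟨?_, fun f => ?_⟩
  · ext x y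
    refine ext_inner_right ℂ fun w => ?_
    simp [star, ContinuousLinearMap.adjoint_inner_left, hK.inner_comm]
  · have h := hK f.support.card (fun i => (f.support.equivFin.symm i : Z))
      (fun i => f (f.support.equivFin.symm i : Z))
      (fun a b hab => f.support.equivFin.symm.injective (Subtype.ext hab))
    have h' := (Complex.le_def.mp h).1
    refine le_of_le_of_eq h' ?_
    have e1 : ∀ g : Z → Z → ℂ,
        ∑ μ : Fin f.support.card, ∑ ν : Fin f.support.card,
          g (f.support.equivFin.symm μ : Z) (f.support.equivFin.symm ν : Z)
        = ∑ a ∈ f.support, ∑ b ∈ f.support, g a b := by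
      intro g
      rw [← Finset.sum_coe_sort f.support,
        ← Equiv.sum_comp f.support.equivFin.symm
          (fun a : f.support => ∑ b ∈ f.support, g a b)]
      refine Finset.sum_congr rfl fun μ _ => ?_
      rw [← Finset.sum_coe_sort f.support]
      exact Equiv.sum_comp f.support.equivFin.symm
        (fun b : f.support => g (f.support.equivFin.symm μ : Z) (b : Z))
    have e2 := e1 (fun a b => inner ℂ (f a) (K a b (f b)))
    rw [e2]
    simp only [Finsupp.sum, Matrix.of_apply]
    congr 1
    refine Finset.sum_congr rfl fun a _ => Finset.sum_congr rfl fun b _ => ?_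
    rw [hK.inner_comm]

instance instFactPosSemidef [CompleteSpace E] (K : Z → Z → E →L[ℂ] E)
    [hK : Fact (IsPosSemidefKernel K)] : Fact (Matrix.of K).PosSemidef :=
  ⟨hK.out.posSemidef⟩

/-- The reproducing kernel Hilbert space of `K`: the completion of the span of the functions
`K_x v : z ↦ K(z, x) v` for the inner product with `⟨K_x v, K_y u⟩ = ⟨v, K(x, y) u⟩`; its elements
are (coerced to) functions `Z → E`. -/
abbrev KernelSpace [CompleteSpace E] (K : Z → Z → E →L[ℂ] E) [Fact (IsPosSemidefKernel K)] :
    Type _ :=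
  RKHS.OfKernel (Matrix.of K)

/-- The reproducing kernel of `KernelSpace K` is `K`. -/
theorem kernel_kernelSpace [CompleteSpace E] (K : Z → Z → E →L[ℂ] E)
    [Fact (IsPosSemidefKernel K)] (x y : Z) : RKHS.kernel (KernelSpace K) x y = K x y := by
  rw [RKHS.OfKernel.kernel_ofKernel]
  rfl

variable [CompleteSpace E] [TopologicalSpace Z]

/-- All functions of the reproducing kernel Hilbert space are continuous. -/
def SubsetC (K : Z → Z → E →L[ℂ] E) [Fact (IsPosSemidefKernel K)] : Prop :=
  ∀ f : KernelSpace K, Continuous (f : Z → E)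

/-- All functions of the reproducing kernel Hilbert space are continuous and vanish at infinity. -/
def SubsetC₀ (K : Z → Z → E →L[ℂ] E) [Fact (IsPosSemidefKernel K)] : Prop :=
  ∀ f : KernelSpace K, ∃ g : ZeroAtInftyContinuousMap Z E, ∀ x, g x = f x

/-- `K` is universal: its space consists of continuous functions and is uniformly dense in
`C(A, E)` for every compact set `A`. -/
def IsUniversal (K : Z → Z → E →L[ℂ] E) [Fact (IsPosSemidefKernel K)] : Prop :=
  SubsetC K ∧ ∀ A : Set Z, IsCompact A → ∀ g : C(A, E), ∀ ε > (0 : ℝ),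
    ∃ f : KernelSpace K, ∀ x : A, ‖f (x : Z) - g x‖ < ε

/-- `K` is `C₀`-universal: its space is contained and uniformly dense in `C₀(Z, E)`. -/
def IsC₀Universal (K : Z → Z → E →L[ℂ] E) [Fact (IsPosSemidefKernel K)] : Prop :=
  SubsetC₀ K ∧ ∀ g : ZeroAtInftyContinuousMap Z E, ∀ ε > (0 : ℝ),
    ∃ f : KernelSpace K, ∀ x : Z, ‖f x - g x‖ < ε

end Kernels

end OpKernel

/-! Integration against `η` is a linear functional on the reproducing kernel space. Its functions
are bounded on the set that carries `η`, so by Banach–Steinhaus the evaluations are uniformly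
bounded there and the functional is continuous. The Riesz vector `k` of this functional is `K_η`
(`exists_isRepresenter`). Testing `k` on the functions `K_y v` gives (i), and testing it on `k`
itself gives (ii).

Hence `⟨K_η, K_η⟩ > 0` exactly when `η` does not annihilate the space
(`IsRepresenter.inner_pos_iff`), and (iii) becomes a duality statement: the space is uniformly dense
if and only if no nonzero regular measure annihilates it. One direction is Hahn–Banach together with
the vector valued Riesz theorem (`IsSupBounded.exists_vectorMeasure`). The other holds because a
regular measure is determined by its integrals of Urysohn functions times vectors
(`IsRadonBV.eq_zero_of_separating`), and density lets the space approximate these.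

The Riesz theorem is reduced to the scalar one. The absolute value `φ ↦ sup {‖L g‖ : ‖g‖ ≤ φ}` of a
bounded functional `L` is additive, so Riesz–Markov gives a finite regular measure `μ` with `‖L g‖ ≤
∫ ‖g‖ dμ`. Therefore `L` extends to a contractive functional `T` on `L¹(μ; E)`, and the Riesz
vectors of `v ↦ T(χ_A v)` form a vector measure whose variation is at most `μ`. -/

namespace OpKernel

open scoped NNReal CompactlySupported

/-! ### The absolute value of a functional on vector valued functions -/

section AbsoluteValue

variable {X E : Type*} [TopologicalSpace X] [NormedAddCommGroup E] [InnerProductSpace ℂ E]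

/-- The values `‖L g‖` for the functions `g` dominated in norm by `φ`. -/
def dominatedValues (L : C_c(X, E) →ₗ[ℂ] ℂ) (φ : X → ℝ≥0) : Set ℝ≥0 :=
  {t | ∃ g : C_c(X, E), (∀ x, ‖g x‖₊ ≤ φ x) ∧ ‖L g‖₊ = t}

/-- The absolute value of a functional `L` on vector valued functions: the functional
`φ ↦ sup {‖L g‖ : ‖g‖ ≤ φ}` on nonnegative functions. -/
noncomputable def absFunctional (L : C_c(X, E) →ₗ[ℂ] ℂ) (φ : X → ℝ≥0) : ℝ≥0 :=
  sSup (dominatedValues L φ)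

/-- `L` is bounded with constant `M` for the supremum norm. -/
def IsSupBounded (L : C_c(X, E) →ₗ[ℂ] ℂ) (M : ℝ≥0) : Prop :=
  ∀ (g : C_c(X, E)) (r : ℝ≥0), (∀ x, ‖g x‖₊ ≤ r) → ‖L g‖₊ ≤ M * r

theorem exists_forall_le_of_compactlySupported (φ : C_c(X, ℝ≥0)) : ∃ r, ∀ x, φ x ≤ r := by
  obtain ⟨r, hr⟩ := (φ.hasCompactSupport.isCompact_range φ.continuous).bddAbove
  exact ⟨r, fun x => hr ⟨x, rfl⟩⟩

theorem dominatedValues_nonempty (L : C_c(X, E) →ₗ[ℂ] ℂ) (φ : X → ℝ≥0) :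
    (dominatedValues L φ).Nonempty :=
  ⟨0, 0, by simp, by simp⟩

theorem IsSupBounded.le_of_mem {L : C_c(X, E) →ₗ[ℂ] ℂ} {M : ℝ≥0} (hL : IsSupBounded L M)
    {φ : X → ℝ≥0} {r : ℝ≥0} (hr : ∀ x, φ x ≤ r) : ∀ t ∈ dominatedValues L φ, t ≤ M * r := by
  rintro _ ⟨g, hg, rfl⟩
  exact hL g r fun x => (hg x).trans (hr x)

theorem IsSupBounded.absFunctional_le {L : C_c(X, E) →ₗ[ℂ] ℂ} {M : ℝ≥0} (hL : IsSupBounded L M)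
    {φ : X → ℝ≥0} {r : ℝ≥0} (hr : ∀ x, φ x ≤ r) : absFunctional L φ ≤ M * r :=
  csSup_le (dominatedValues_nonempty L φ) (hL.le_of_mem hr)

theorem IsSupBounded.le_absFunctional {L : C_c(X, E) →ₗ[ℂ] ℂ} {M : ℝ≥0} (hL : IsSupBounded L M)
    {φ : X → ℝ≥0} {r : ℝ≥0} (hr : ∀ x, φ x ≤ r) {g : C_c(X, E)} (hg : ∀ x, ‖g x‖₊ ≤ φ x) :
    ‖L g‖₊ ≤ absFunctional L φ :=
  le_csSup ⟨_, hL.le_of_mem hr⟩ ⟨g, hg, rfl⟩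

/-- A function dominated in norm by a continuous function is continuous if it is so away from
the zeros of the latter. -/
theorem continuous_of_norm_le {X E : Type*} [TopologicalSpace X] [NormedAddCommGroup E]
    {f g : X → E} (hg : Continuous g) (hfg : ∀ x, ‖f x‖ ≤ ‖g x‖)
    (hf : ∀ x, g x ≠ 0 → ContinuousAt f x) : Continuous f := by
  rw [continuous_iff_continuousAt]
  intro x
  by_cases hx : g x = 0
  · have h0 : f x = 0 := by simpa [hx] using hfg x
    rw [ContinuousAt, h0, tendsto_zero_iff_norm_tendsto_zero]
    refine squeeze_zero (fun _ => norm_nonneg _) hfg ?_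
    simpa [hx] using (hg.norm.tendsto x)
  · exact hf x hx

/-- Riesz decomposition: `g` is split in the proportions `φ / (φ + ψ)` and `ψ / (φ + ψ)`. This
yields subadditivity of the absolute value. -/
theorem exists_add_eq_of_norm_le_add (g : C_c(X, E)) (φ ψ : C_c(X, ℝ≥0))
    (h : ∀ x, ‖g x‖₊ ≤ φ x + ψ x) :
    ∃ g₁ g₂ : C_c(X, E), g = g₁ + g₂ ∧ (∀ x, ‖g₁ x‖₊ ≤ φ x) ∧ ∀ x, ‖g₂ x‖₊ ≤ ψ x := by
  have key : ∀ φ ψ : C_c(X, ℝ≥0), (∀ x, ‖g x‖₊ ≤ φ x + ψ x) →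
      ∃ g₁ : C_c(X, E), (∀ x, g₁ x = ((φ x : ℝ) / (φ x + ψ x : ℝ) : ℝ) • g x) ∧
        ∀ x, ‖g₁ x‖₊ ≤ φ x := by
    intro φ ψ h
    have hcont : Continuous fun x => ((φ x : ℝ) / (φ x + ψ x : ℝ) : ℝ) • g x := by
      -- The quotient may jump where `φ + ψ` vanishes, but `g` vanishes there and dominates the
      -- product.
      refine continuous_of_norm_le g.continuous (fun x => ?_) fun x hx => ?_
      · rw [norm_smul, Real.norm_of_nonneg (by positivity)]
        refine mul_le_of_le_one_left (norm_nonneg _) (div_le_one_of_le₀ ?_ (by positivity))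
        exact le_add_of_nonneg_right (ψ x).2
      · have hpos : (φ x + ψ x : ℝ) ≠ 0 := by
          have h1 : 0 < ‖g x‖₊ := by simpa using hx
          exact_mod_cast (h1.trans_le (h x)).ne'
        have := φ.continuous
        have := ψ.continuous
        have := g.continuous
        have h1 : ContinuousAt (fun x => (φ x : ℝ)) x := by fun_prop
        have h2 : ContinuousAt (fun x => (φ x + ψ x : ℝ)) x := by fun_prop
        exact (h1.div h2 hpos).smul g.continuous.continuousAt
    refine ⟨⟨⟨_, hcont⟩, g.hasCompactSupport.smul_left⟩, fun x => rfl, fun x => ?_⟩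
    rw [← NNReal.coe_le_coe, coe_nnnorm]
    change ‖((φ x : ℝ) / (φ x + ψ x : ℝ) : ℝ) • g x‖ ≤ φ x
    rw [norm_smul, Real.norm_of_nonneg (by positivity)]
    have hx : ‖g x‖ ≤ φ x + ψ x := by exact_mod_cast h x
    rcases eq_or_ne (φ x + ψ x : ℝ) 0 with h0 | h0
    · simp [h0]
    · calc _ ≤ (φ x : ℝ) / (φ x + ψ x : ℝ) * (φ x + ψ x) := by gcongr
        _ = φ x := div_mul_cancel₀ _ h0
  obtain ⟨g₁, h1, h1'⟩ := key φ ψ h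
  obtain ⟨g₂, h2, h2'⟩ := key ψ φ fun x => by rw [add_comm]; exact h x
  refine ⟨g₁, g₂, ?_, h1', h2'⟩
  ext x
  rw [CompactlySupportedContinuousMap.add_apply, h1, h2, ← add_smul, add_comm (ψ x : ℝ),
    ← add_div]
  rcases eq_or_ne (φ x + ψ x : ℝ) 0 with h0 | h0
  · have : g x = 0 := by
      have hx : ‖g x‖ ≤ φ x + ψ x := by exact_mod_cast h x
      rw [h0] at hx
      simpa using hx
    simp [this]
  · rw [div_self h0, one_smul]

/-- Multiplication by a phase makes values of `L` nonnegative reals, so that they add without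
cancellation. This yields superadditivity of the absolute value. -/
theorem exists_smul_apply_eq_norm (L : C_c(X, E) →ₗ[ℂ] ℂ) (g : C_c(X, E)) :
    ∃ g' : C_c(X, E), (∀ x, ‖g' x‖₊ = ‖g x‖₊) ∧ L g' = (‖L g‖ : ℂ) := by
  obtain ⟨c, hc, hc'⟩ : ∃ c : ℂ, ‖c‖ = 1 ∧ c * L g = ‖L g‖ := by
    rcases eq_or_ne (L g) 0 with h | h
    · exact ⟨1, by simp, by simp [h]⟩
    · have h0 : ‖L g‖ ≠ 0 := by simpa
      refine ⟨‖L g‖ / L g, by simp [h0], by field_simp⟩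
  refine ⟨c • g, fun x => ?_, by rw [map_smul, smul_eq_mul, hc']⟩
  have : ‖c‖₊ = 1 := by ext; exact hc
  simp [nnnorm_smul, this]

theorem IsSupBounded.absFunctional_add {L : C_c(X, E) →ₗ[ℂ] ℂ} {M : ℝ≥0} (hL : IsSupBounded L M)
    (φ ψ : C_c(X, ℝ≥0)) :
    absFunctional L (φ + ψ : C_c(X, ℝ≥0)) = absFunctional L φ + absFunctional L ψ := by
  obtain ⟨r, hr⟩ := exists_forall_le_of_compactlySupported φ
  obtain ⟨s, hs⟩ := exists_forall_le_of_compactlySupported ψ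
  obtain ⟨t, ht⟩ := exists_forall_le_of_compactlySupported (φ + ψ)
  apply le_antisymm
  · refine csSup_le (dominatedValues_nonempty _ _) ?_
    rintro _ ⟨g, hg, rfl⟩
    obtain ⟨g₁, g₂, rfl, h1, h2⟩ := exists_add_eq_of_norm_le_add g φ ψ hg
    rw [map_add]
    exact (nnnorm_add_le _ _).trans
      (add_le_add (hL.le_absFunctional hr h1) (hL.le_absFunctional hs h2))
  · have h : ∀ a ∈ dominatedValues L φ, ∀ b ∈ dominatedValues L ψ,
        a + b ≤ absFunctional L (φ + ψ : C_c(X, ℝ≥0)) := by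
      rintro _ ⟨g₁, h1, rfl⟩ _ ⟨g₂, h2, rfl⟩
      obtain ⟨g₁', h1', e1⟩ := exists_smul_apply_eq_norm L g₁
      obtain ⟨g₂', h2', e2⟩ := exists_smul_apply_eq_norm L g₂
      refine le_of_eq_of_le ?_ (hL.le_absFunctional (g := g₁' + g₂') ht fun x => ?_)
      · ext
        rw [map_add, e1, e2, ← Complex.ofReal_add, NNReal.coe_add, coe_nnnorm, coe_nnnorm,
          coe_nnnorm, Complex.norm_real, Real.norm_of_nonneg (by positivity)]
      · exact (nnnorm_add_le _ _).trans
          (add_le_add ((h1' x).trans_le (h1 x)) ((h2' x).trans_le (h2 x)))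
    have hb : ∀ b ∈ dominatedValues L ψ,
        absFunctional L φ + b ≤ absFunctional L (φ + ψ : C_c(X, ℝ≥0)) := by
      intro b hb
      obtain ⟨a, ha⟩ := dominatedValues_nonempty L φ
      -- Subtraction in `ℝ≥0` is truncated, so `b` must be known to lie below the bound before it is
      -- moved across to take the supremum over `a`.
      refine add_le_of_le_tsub_right_of_le (le_of_add_le_right (h a ha b hb)) ?_
      exact csSup_le (dominatedValues_nonempty _ _)
        fun a ha => le_tsub_of_add_le_right (h a ha b hb)
    obtain ⟨b, hb'⟩ := dominatedValues_nonempty L ψ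
    refine add_le_of_le_tsub_left_of_le (le_of_add_le_left (hb b hb')) ?_
    exact csSup_le (dominatedValues_nonempty _ _)
      fun b hb' => le_tsub_of_add_le_left (hb b hb')

theorem IsSupBounded.absFunctional_smul {L : C_c(X, E) →ₗ[ℂ] ℂ} {M : ℝ≥0}
    (hL : IsSupBounded L M) (c : ℝ≥0) (φ : C_c(X, ℝ≥0)) :
    absFunctional L (c • φ : C_c(X, ℝ≥0)) = c * absFunctional L φ := by
  -- One inequality suffices: applied to `c` and to `c⁻¹` it gives both directions.
  have key : ∀ (c : ℝ≥0), c ≠ 0 → ∀ φ : C_c(X, ℝ≥0),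
      absFunctional L φ ≤ c⁻¹ * absFunctional L (c • φ : C_c(X, ℝ≥0)) := by
    intro c hc φ
    obtain ⟨r, hr⟩ := exists_forall_le_of_compactlySupported (c • φ)
    refine csSup_le (dominatedValues_nonempty _ _) ?_
    rintro _ ⟨g, hg, rfl⟩
    have h : ‖L (((c : ℝ) : ℂ) • g)‖₊ ≤ absFunctional L (c • φ : C_c(X, ℝ≥0)) := by
      refine hL.le_absFunctional hr fun x => ?_
      have : ‖((c : ℝ) : ℂ)‖₊ = c := by ext; simp
      rw [CompactlySupportedContinuousMap.smul_apply, nnnorm_smul, this,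
        CompactlySupportedContinuousMap.smul_apply, smul_eq_mul]
      gcongr
      exact hg x
    have hn : ‖L (((c : ℝ) : ℂ) • g)‖₊ = c * ‖L g‖₊ := by
      rw [map_smul, nnnorm_smul]
      congr 1
      ext; simp
    rw [hn] at h
    rwa [← div_eq_inv_mul, le_div_iff₀ (pos_iff_ne_zero.2 hc), mul_comm]
  rcases eq_or_ne c 0 with rfl | hc
  · rw [zero_mul]
    have := hL.absFunctional_le (φ := ((0 : ℝ≥0) • φ : C_c(X, ℝ≥0))) (r := 0) (by simp)
    simpa using this
  · apply le_antisymm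
    · have h := key c⁻¹ (inv_ne_zero hc) (c • φ)
      rwa [inv_inv, smul_smul, inv_mul_cancel₀ hc, one_smul] at h
    · have h := key c hc φ
      rwa [← div_eq_inv_mul, le_div_iff₀ (pos_iff_ne_zero.2 hc), mul_comm] at h

/-- The absolute value of a bounded functional as a positive linear functional. -/
noncomputable def absLinearMap (L : C_c(X, E) →ₗ[ℂ] ℂ) {M : ℝ≥0} (hL : IsSupBounded L M) :
    C_c(X, ℝ≥0) →ₗ[ℝ≥0] ℝ≥0 where
  toFun φ := absFunctional L φ
  map_add' := hL.absFunctional_add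
  map_smul' := hL.absFunctional_smul

end AbsoluteValue

theorem norm_toL1_eq_integral_norm {Z E : Type*} [MeasurableSpace Z] [NormedAddCommGroup E]
    {μ : Measure Z} {F : Z → E} (hF : Integrable F μ) : ‖hF.toL1 F‖ = ∫ x, ‖F x‖ ∂μ := by
  rw [Integrable.norm_toL1_eq_lintegral_enorm, integral_norm_eq_lintegral_enorm hF.1]

/-! ### Domination by a scalar measure and extension to `L¹` -/

section Dominating

variable {X E : Type*} [TopologicalSpace X] [T2Space X] [LocallyCompactSpace X]
  [MeasurableSpace X] [BorelSpace X] [NormedAddCommGroup E] [InnerProductSpace ℂ E]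

/-- A functional bounded for the supremum norm is bounded for the `L¹` norm of some finite
regular measure. -/
theorem IsSupBounded.exists_measure {L : C_c(X, E) →ₗ[ℂ] ℂ} {M : ℝ≥0} (hL : IsSupBounded L M) :
    ∃ μ : Measure X, IsFiniteMeasure μ ∧ μ.Regular ∧ ∀ g : C_c(X, E), ‖L g‖ ≤ ∫ x, ‖g x‖ ∂μ := by
  set μ := NNRealRMK.rieszMeasure (absLinearMap L hL) with hμ
  have hreg : μ.Regular := inferInstance
  refine ⟨μ, ⟨?_⟩, hreg, fun g => ?_⟩
  · refine lt_of_le_of_lt (b := (M : ENNReal)) ?_ ENNReal.coe_lt_top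
    -- By inner regularity it is enough to bound compact sets. A Urysohn function with values in
    -- `[0, 1]` that is `1` on `C` shows that `μ C ≤ M`.
    rw [isOpen_univ.measure_eq_iSup_isCompact]
    refine iSup_le fun C => iSup_le fun _ => iSup_le fun hC => ?_
    obtain ⟨f, hf1, -, hfc, hf01⟩ := exists_continuous_one_zero_of_isCompact hC
      (isClosed_empty (X := X)) (Set.disjoint_empty _)
    let φ : C_c(X, ℝ≥0) := ⟨⟨fun x => (f x).toNNReal, by fun_prop⟩,
      hfc.comp_left Real.toNNReal_zero⟩
    have hφ : ∀ x, φ x ≤ 1 := fun x => by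
      change (f x).toNNReal ≤ 1
      simpa using (hf01 x).2
    calc μ C = ∫⁻ x in C, 1 ∂μ := by simp
      _ ≤ ∫⁻ x in C, φ x ∂μ := by
        refine setLIntegral_mono' hC.measurableSet fun x hx => ?_
        have : φ x = 1 := by
          change (f x).toNNReal = 1
          rw [hf1 hx]; simp
        simp [this]
      _ ≤ ∫⁻ x, φ x ∂μ := setLIntegral_le_lintegral _ _
      _ = absFunctional L φ := NNRealRMK.lintegral_rieszMeasure (absLinearMap L hL) φ
      _ ≤ M := by
        have := hL.absFunctional_le hφ
        rw [mul_one] at this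
        exact_mod_cast this
  · let φ : C_c(X, ℝ≥0) := ⟨⟨fun x => ‖g x‖₊, by have := g.continuous; fun_prop⟩,
      g.hasCompactSupport.comp_left (g := fun v : E => ‖v‖₊) nnnorm_zero⟩
    have h1 : ∫ x, ‖g x‖ ∂μ = absFunctional L φ :=
      NNRealRMK.integral_rieszMeasure (absLinearMap L hL) φ
    rw [h1]
    obtain ⟨r, hr⟩ := exists_forall_le_of_compactlySupported φ
    exact_mod_cast hL.le_absFunctional (g := g) hr fun x => le_rfl

theorem integrable_of_compactlySupported {X E : Type*} [TopologicalSpace X] [MeasurableSpace X]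
    [OpensMeasurableSpace X] [NormedAddCommGroup E] (μ : Measure X) [IsFiniteMeasureOnCompacts μ]
    (g : C_c(X, E)) : Integrable g μ :=
  g.continuous.integrable_of_hasCompactSupport g.hasCompactSupport

/-- The inclusion of the compactly supported functions into `L¹`. -/
noncomputable def toL1LinearMap (E : Type*) [NormedAddCommGroup E] [InnerProductSpace ℂ E]
    (μ : Measure X) [IsFiniteMeasureOnCompacts μ] :
    C_c(X, E) →ₗ[ℂ] Lp E 1 μ where
  toFun g := (integrable_of_compactlySupported μ g).toL1 g
  map_add' _ _ := rfl
  map_smul' _ _ := rfl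

/-- The bound makes `L` depend only on the `L¹` class of `g`, so `L` descends to a contraction on
the image of `C_c(X, E)`, which Hahn–Banach extends with the same norm. -/
theorem exists_L1_extension {X E : Type*} [TopologicalSpace X] [MeasurableSpace X] [BorelSpace X]
    [NormedAddCommGroup E] [InnerProductSpace ℂ E] {L : C_c(X, E) →ₗ[ℂ] ℂ} (μ : Measure X)
    [IsFiniteMeasureOnCompacts μ]
    (hL : ∀ g : C_c(X, E), ‖L g‖ ≤ ∫ x, ‖g x‖ ∂μ) :
    ∃ T : Lp E 1 μ →L[ℂ] ℂ, (∀ f, ‖T f‖ ≤ ‖f‖) ∧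
      ∀ g : C_c(X, E), T ((integrable_of_compactlySupported μ g).toL1 g) = L g := by
  have hnorm : ∀ g, ‖L g‖ ≤ 1 * ‖toL1LinearMap E μ g‖ := fun g => by
    rw [one_mul]
    exact (hL g).trans_eq (norm_toL1_eq_integral_norm (integrable_of_compactlySupported μ g)).symm
  let ℓ := L.compLeftInverse (toL1LinearMap E μ)
  have hℓ : ∀ g, ℓ ⟨toL1LinearMap E μ g, g, rfl⟩ = L g := fun g =>
    LinearMap.compLeftInverse_apply_of_bdd _ _ ⟨1, hnorm⟩ g _ rfl
  obtain ⟨T, hT, hTn⟩ := exists_extension_norm_eq (LinearMap.range (toL1LinearMap E μ)) ℓ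
  refine ⟨T, fun f => ?_, fun g => (hT ⟨toL1LinearMap E μ g, g, rfl⟩).trans (hℓ g)⟩
  have h1 : ‖T‖ ≤ 1 := by
    rw [hTn]
    refine ℓ.opNorm_le_bound zero_le_one ?_
    rintro ⟨_, g, rfl⟩
    rw [hℓ]
    exact hnorm g
  simpa using T.le_of_opNorm_le h1 f

end Dominating

/-! ### Functionals on `L¹(μ; E)` as vector measures -/

section L1

variable {Z E : Type*} [MeasurableSpace Z] [NormedAddCommGroup E] [InnerProductSpace ℂ E]

/-- An additive functional bounded for the `L¹` norm and vanishing on indicator functions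
vanishes. -/
theorem eq_zero_of_forall_indicator {E : Type*} [NormedAddCommGroup E] {μ : Measure Z}
    {Φ : (Z → E) → ℂ} {C : ℝ}
    (hadd : ∀ F G, Integrable F μ → Integrable G μ → Φ (F + G) = Φ F + Φ G)
    (hbound : ∀ F, Integrable F μ → ‖Φ F‖ ≤ C * ∫ x, ‖F x‖ ∂μ)
    (hind : ∀ (A : Set Z) (v : E), MeasurableSet A → μ A < ⊤ → Φ (A.indicator fun _ => v) = 0)
    {F : Z → E} (hF : Integrable F μ) : Φ F = 0 := by
  -- `Φ` acts on functions, not on classes; its invariance under almost everywhere equality has to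
  -- be extracted from the bound.
  have hzero : ∀ F, F =ᵐ[μ] 0 → Φ F = 0 := fun F h => by
    have h0 := hbound F ((integrable_zero Z E μ).congr h.symm)
    have : ∫ x, ‖F x‖ ∂μ = 0 := integral_eq_zero_of_ae (h.mono fun x hx => by simp [hx])
    simpa [this] using h0
  have hsub : ∀ F G, Integrable F μ → Integrable G μ → Φ F = Φ (F - G) + Φ G := fun F G h1 h2 => by
    rw [← hadd _ _ (h1.sub h2) h2, sub_add_cancel]
  have hcongr : ∀ F G, F =ᵐ[μ] G → Integrable F μ → Φ F = Φ G := fun F G h hi => by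
    rw [hsub F G hi (hi.congr h), hzero _ (h.mono fun x hx => by simp [hx]), zero_add]
  refine Integrable.induction (fun F => Φ F = 0) (fun v A hA hμ => hind A v hA hμ)
    (fun F G _ h1 h2 h3 h4 => by rw [hadd F G h1 h2, h3, h4, zero_add]) ?_
    (fun F G h hi h0 => by rw [← hcongr F G h hi, h0]) hF
  have hlip : LipschitzWith C.toNNReal (fun f : Lp E 1 μ => Φ f) := by
    refine LipschitzWith.of_dist_le_mul fun f g => ?_
    have hf := L1.integrable_coeFn f
    have hg := L1.integrable_coeFn g
    rw [dist_eq_norm, hsub f g hf hg, add_sub_cancel_right, dist_eq_norm]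
    refine (hbound _ (hf.sub hg)).trans ?_
    rw [L1.norm_eq_integral_norm]
    have : ∫ x, ‖(f - g : Lp E 1 μ) x‖ ∂μ = ∫ x, ‖(f - g : Z → E) x‖ ∂μ :=
      integral_congr_ae ((Lp.coeFn_sub f g).mono fun x hx => congrArg norm hx)
    rw [this]
    exact mul_le_mul_of_nonneg_right (Real.le_coe_toNNReal C)
      (integral_nonneg fun _ => norm_nonneg _)
  exact isClosed_eq hlip.continuous continuous_const

theorem norm_pairing_le : ‖pairing E‖ ≤ 1 := by
  refine (pairing E).opNorm_le_bound₂ zero_le_one fun a b => ?_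
  rw [pairing_apply, one_mul, mul_comm]
  exact norm_inner_le_norm b a

theorem norm_bartleIntegral_le (η : VectorMeasure Z E) (F : Z → E) :
    ‖bartleIntegral η F‖ ≤ ∫ x, ‖F x‖ ∂η.variation := by
  refine VectorMeasure.norm_integral_le_integral_norm.trans ?_
  exact mul_le_of_le_one_left (integral_nonneg fun _ => norm_nonneg _) norm_pairing_le

theorem bartleIntegral_indicator (η : VectorMeasure Z E) [IsFiniteMeasure η.variation]
    {A : Set Z} (hA : MeasurableSet A) (v : E) :
    bartleIntegral η (A.indicator fun _ => v) = inner ℂ (η A) v := by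
  refine (setToFun_indicator_const _ hA (measure_ne_top _ _) v).trans ?_
  rw [transpose_eq_cbmApplyMeasure, cbmApplyMeasure_apply, pairing_apply]

variable [CompleteSpace E]

open Classical in
/-- A contractive functional on `L¹(μ; E)` is integration against a vector measure that is
dominated by `μ`. -/
theorem exists_vectorMeasure_of_L1_functional {μ : Measure Z} [IsFiniteMeasure μ]
    (T : Lp E 1 μ →L[ℂ] ℂ) (hT : ∀ f, ‖T f‖ ≤ ‖f‖) :
    ∃ η : VectorMeasure Z E, η.variation ≤ μ ∧
      ∀ F (hF : Integrable F μ), T (hF.toL1 F) = bartleIntegral η F := by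
  have hind : ∀ A, MeasurableSet A → ∀ v : E, Integrable (A.indicator fun _ => v) μ :=
    fun A hA v => (integrable_const v).indicator hA
  let ℓ : ∀ A, MeasurableSet A → E →L[ℂ] ℂ := fun A hA => LinearMap.mkContinuous
    { toFun v := T ((hind A hA v).toL1 _)
      map_add' u v := by
        rw [← map_add, ← Integrable.toL1_add]
        congr 1
        simp only [Integrable.toL1_eq_toL1_iff]
        exact Eventually.of_forall fun x => by by_cases h : x ∈ A <;> simp [h]
      map_smul' c v := by
        rw [RingHom.id_apply, ← map_smul, ← Integrable.toL1_smul]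
        congr 1
        simp only [Integrable.toL1_eq_toL1_iff]
        exact Eventually.of_forall fun x => by by_cases h : x ∈ A <;> simp [h] }
    (μ.real A) fun v => by
      refine (hT _).trans ?_
      rw [norm_toL1_eq_integral_norm]
      simp only [norm_indicator_eq_indicator_norm]
      rw [integral_indicator_const _ hA, smul_eq_mul]
  have hℓ : ∀ A hA v, ℓ A hA v = T ((hind A hA v).toL1 _) := fun A hA v => rfl
  have hℓn : ∀ A hA, ‖ℓ A hA‖ ≤ μ.real A := fun A hA =>
    LinearMap.mkContinuous_norm_le _ measureReal_nonneg _
  let m : Set Z → E := fun A =>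
    if hA : MeasurableSet A then (InnerProductSpace.toDual ℂ E).symm (ℓ A hA) else 0
  have hm : ∀ A (hA : MeasurableSet A) v, inner ℂ (m A) v = ℓ A hA v := fun A hA v => by
    simp only [m, dif_pos hA, InnerProductSpace.toDual_symm_apply]
  have hbound : ∀ A, ‖m A‖ₑ ≤ μ A := fun A => by
    by_cases hA : MeasurableSet A
    · simp only [m, dif_pos hA, LinearIsometryEquiv.enorm_map]
      rw [← ofReal_norm, ← ofReal_measureReal]
      exact ENNReal.ofReal_le_ofReal (hℓn A hA)
    · simp [m, hA]
  -- Domination by the finite measure `μ` upgrades finite additivity to countable additivity.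
  let η : VectorMeasure Z E := VectorMeasure.of_additive_of_le_measure m hbound
    (fun A B hA hB hAB => by
      refine ext_inner_right ℂ fun v => ?_
      rw [inner_add_left, hm _ (hA.union hB), hm _ hA, hm _ hB, hℓ _ (hA.union hB), hℓ _ hA,
        hℓ _ hB, ← map_add, ← Integrable.toL1_add]
      congr 1
      simp only [Integrable.toL1_eq_toL1_iff]
      rw [Set.indicator_union_of_disjoint hAB]
      rfl)
    (fun A hA => by simp [m, hA])
  have hvar : η.variation ≤ μ := VectorMeasure.variation_le_of_forall_enorm_le fun A _ => hbound A
  have : IsFiniteMeasure η.variation := isFiniteMeasure_of_le μ hvar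
  refine ⟨η, hvar, fun F hF => ?_⟩
  let Φ : (Z → E) → ℂ := fun F =>
    (if hF : Integrable F μ then T (hF.toL1 F) else 0) - bartleIntegral η F
  have key : Φ F = 0 := by
    -- The constant `2` counts one for the contraction `T` and one for the integral against `η`.
    refine eq_zero_of_forall_indicator (μ := μ) (C := 2) ?_ ?_ ?_ hF
    · intro F G hF hG
      simp only [Φ, dif_pos hF, dif_pos hG, dif_pos (hF.add hG)]
      have : bartleIntegral η (F + G) = bartleIntegral η F + bartleIntegral η G :=
        bartleIntegral_add η (hF.mono_measure hvar) (hG.mono_measure hvar)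
      rw [this, Integrable.toL1_add _ _ hF hG, map_add]
      ring
    · intro F hF
      simp only [Φ, dif_pos hF]
      refine (norm_sub_le _ _).trans ?_
      rw [two_mul]
      refine add_le_add ((hT _).trans_eq (norm_toL1_eq_integral_norm hF)) ?_
      exact (norm_bartleIntegral_le η F).trans
        (integral_mono_measure hvar (Eventually.of_forall fun _ => norm_nonneg _) hF.norm)
    · intro A v hA _
      simp only [Φ, dif_pos (hind A hA v)]
      rw [bartleIntegral_indicator η hA, sub_eq_zero]
      exact (hm A hA v).symm
  simp only [Φ, dif_pos hF] at key
  exact sub_eq_zero.1 key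

end L1

/-! ### The vector valued Riesz representation theorem -/

section Riesz

variable {X E : Type*} [TopologicalSpace X] [T2Space X] [MeasurableSpace X] [BorelSpace X]
  [NormedAddCommGroup E] [InnerProductSpace ℂ E]

/-- A measure dominated by a finite regular measure is regular. -/
theorem regular_of_le {μ ν : Measure X} [IsFiniteMeasure μ] [μ.Regular] (h : ν ≤ μ) :
    ν.Regular := by
  have : IsFiniteMeasure ν := isFiniteMeasure_of_le μ h
  have : ν.InnerRegularCompactLTTop := by
    refine ⟨fun A hA r hr => ?_⟩
    -- Since `ν ≤ μ`, a compact set that exhausts `A` up to small `μ`-measure does so for `ν`.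
    obtain ⟨C, hCA, hC, hlt⟩ := hA.1.exists_isCompact_sdiff_lt (measure_ne_top μ A)
      (tsub_pos_of_lt hr).ne'
    refine ⟨C, hCA, hC, ?_⟩
    by_contra! hCr
    have h1 : ν A ≤ ν C + ν (A \ C) := by
      rw [← measure_union Set.disjoint_sdiff_right (hA.1.diff hC.measurableSet),
        Set.union_sdiff_cancel hCA]
    have h2 : ν (A \ C) < ν A - r := (h _).trans_lt hlt
    have h3 : ν C + ν (A \ C) < r + (ν A - r) :=
      ENNReal.add_lt_add_of_le_of_lt (measure_ne_top ν C) hCr h2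
    rw [add_tsub_cancel_of_le hr.le] at h3
    exact absurd h1 h3.not_ge
  infer_instance

/-- Every functional on the compactly supported continuous functions with values in a Hilbert
space that is bounded for the supremum norm is integration against a regular vector measure of
bounded variation. -/
theorem IsSupBounded.exists_vectorMeasure [LocallyCompactSpace X] [CompleteSpace E]
    {L : C_c(X, E) →ₗ[ℂ] ℂ} {M : ℝ≥0} (hL : IsSupBounded L M) :
    ∃ η : VectorMeasure X E, IsRadonBV η ∧ ∀ g : C_c(X, E), L g = bartleIntegral η g := by
  obtain ⟨μ, hμ, hreg, hLμ⟩ := hL.exists_measure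
  obtain ⟨T, hT, hTL⟩ := exists_L1_extension μ hLμ
  obtain ⟨η, hη, hηT⟩ := exists_vectorMeasure_of_L1_functional T hT
  exact ⟨η, ⟨isFiniteMeasure_of_le μ hη, regular_of_le hη⟩,
    fun g => by rw [← hTL, hηT]⟩

end Riesz

theorem norm_bartleIntegral_le_of_forall_le {Z E : Type*} [MeasurableSpace Z]
    [NormedAddCommGroup E] [InnerProductSpace ℂ E] (η : VectorMeasure Z E)
    [IsFiniteMeasure η.variation] {F : Z → E} {r : ℝ} (hr : ∀ᵐ x ∂η.variation, ‖F x‖ ≤ r) (h0 : 0 ≤ r) :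
    ‖bartleIntegral η F‖ ≤ r * η.variation.real Set.univ := by
  refine (VectorMeasure.norm_integral_le_of_norm_le_const hr).trans ?_
  have := norm_pairing_le (E := E)
  have h1 : r * ‖pairing E‖ ≤ r := mul_le_of_le_one_right h0 this
  gcongr

/-! ### Continuous functions and regular vector measures -/

section Regularity

variable {Z E : Type*} [TopologicalSpace Z] [T2Space Z] [MeasurableSpace Z] [BorelSpace Z]
  [NormedAddCommGroup E]

/-- A continuous function is almost everywhere strongly measurable for a finite regular measure:
its restriction to a suitable conull `σ`-compact set has separable range. -/
theorem aestronglyMeasurable_of_continuous {μ : Measure Z} [IsFiniteMeasure μ] [μ.Regular]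
    {f : Z → E} (hf : Continuous f) : AEStronglyMeasurable f μ := by
  borelize E
  rw [aestronglyMeasurable_iff_aemeasurable_separable]
  refine ⟨hf.measurable.aemeasurable, ?_⟩
  have h : ∀ n : ℕ, ∃ C : Set Z, IsCompact C ∧ μ Cᶜ < (n + 1 : ENNReal)⁻¹ := fun n => by
    obtain ⟨C, -, hC, hlt⟩ := MeasurableSet.univ.exists_isCompact_sdiff_lt (measure_ne_top μ _)
      (ε := (n + 1 : ENNReal)⁻¹) (by simp)
    exact ⟨C, hC, by rwa [Set.compl_eq_univ_sdiff]⟩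
  choose C hC hlt using h
  refine ⟨⋃ n, f '' C n,
    TopologicalSpace.IsSeparable.iUnion fun n => ((hC n).image hf).isSeparable, ?_⟩
  have hnull : μ (⋃ n, C n)ᶜ = 0 := by
    refine le_antisymm (ge_of_tendsto' (x := atTop) (f := fun n : ℕ => (n + 1 : ENNReal)⁻¹) ?_
      fun n => ?_) zero_le
    · have := ENNReal.tendsto_inv_nat_nhds_zero.comp (tendsto_add_atTop_nat 1)
      refine this.congr fun n => by simp
    · exact (measure_mono (Set.compl_subset_compl.2 (Set.subset_iUnion C n))).trans (hlt n).le
  refine mem_of_superset (compl_mem_ae_iff.2 hnull) fun x hx => ?_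
  rw [compl_compl] at hx
  obtain ⟨n, hn⟩ := Set.mem_iUnion.1 hx
  exact Set.mem_iUnion.2 ⟨n, x, hn, rfl⟩

theorem integrable_of_continuous {μ : Measure Z} [IsFiniteMeasure μ] [μ.Regular]
    {f : Z → E} (hf : Continuous f) {r : ℝ} (hr : ∀ᵐ x ∂μ, ‖f x‖ ≤ r) : Integrable f μ :=
  Integrable.of_bound (aestronglyMeasurable_of_continuous hf) r hr

variable [InnerProductSpace ℂ E]

/-- A regular vector measure vanishes if it annihilates enough functions that separate compact
sets from the complements of their open neighbourhoods. -/
theorem IsRadonBV.eq_zero_of_separating {η : VectorMeasure Z E} (hη : IsRadonBV η)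
    (h : ∀ C U : Set Z, IsCompact C → IsOpen U → C ⊆ U → ∀ v : E, ∃ φ : Z → ℝ,
      AEStronglyMeasurable φ η.variation ∧ (∀ x, φ x ∈ Set.Icc (0 : ℝ) 1) ∧
        (∀ᵐ x ∂η.variation, x ∈ C → φ x = 1) ∧ (∀ᵐ x ∂η.variation, x ∉ U → φ x = 0) ∧
        bartleIntegral η (fun x => φ x • v) = 0) :
    η = 0 := by
  have := hη.finite
  have := hη.regular
  have hcomp : ∀ C, IsCompact C → η C = 0 := by
    intro C hC
    refine ext_inner_right ℂ fun v => ?_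
    rw [inner_zero_left, ← norm_le_zero_iff]
    refine le_of_forall_pos_le_add fun ε hε => ?_
    rw [zero_add]
    -- The functions `χ_C v` and `φ v` differ only on `U \ C`, by at most `‖v‖`. The `+ 1` in the
    -- denominator allows `v = 0`.
    obtain ⟨U, hCU, hU, -, hlt⟩ := hC.measurableSet.exists_isOpen_sdiff_lt
      (measure_ne_top η.variation C) (ε := ENNReal.ofReal (ε / (‖v‖ + 1)))
      (by simp only [ne_eq, ENNReal.ofReal_eq_zero, not_le]; positivity)
    obtain ⟨φ, hm, h01, h1, h0, hb⟩ := h C U hC hU hCU v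
    have hi1 : Integrable (C.indicator fun _ => v) η.variation :=
      (integrable_const v).indicator hC.measurableSet
    have hi2 : Integrable (fun x => φ x • v) η.variation := by
      refine Integrable.smul_const (Integrable.of_bound hm 1 (Eventually.of_forall fun x => ?_)) v
      rw [Real.norm_of_nonneg (h01 x).1]
      exact (h01 x).2
    have e : bartleIntegral η (fun x => C.indicator (fun _ => v) x - φ x • v) =
        inner ℂ (η C) v := by
      have := VectorMeasure.integral_fun_sub (B := pairing E) hi1 hi2
      refine this.trans ?_
      change bartleIntegral η (C.indicator fun _ => v) - bartleIntegral η (fun x => φ x • v) = _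
      rw [hb, sub_zero, bartleIntegral_indicator η hC.measurableSet]
    rw [← e]
    refine (norm_bartleIntegral_le _ _).trans ?_
    have hle : ∀ᵐ x ∂η.variation, ‖C.indicator (fun _ => v) x - φ x • v‖ ≤
        (U \ C).indicator (fun _ => ‖v‖) x := by
      filter_upwards [h0, h1] with x hx hx1
      by_cases hxC : x ∈ C
      · simp [hxC, hx1 hxC]
      · by_cases hxU : x ∈ U
        · simp only [hxC, not_false_eq_true, Set.indicator_of_notMem, zero_sub, norm_neg,
            Set.mem_sdiff, hxU, and_self, Set.indicator_of_mem, norm_smul]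
          rw [Real.norm_of_nonneg (h01 x).1]
          exact mul_le_of_le_one_left (norm_nonneg _) (h01 x).2
        · simp [hxC, hxU, hx hxU]
    refine (integral_mono_ae (hi1.sub hi2).norm ((integrable_const ‖v‖).indicator
      (hU.measurableSet.diff hC.measurableSet)) hle).trans ?_
    rw [integral_indicator_const _ (hU.measurableSet.diff hC.measurableSet), smul_eq_mul]
    have h2 : η.variation.real (U \ C) ≤ ε / (‖v‖ + 1) :=
      ENNReal.toReal_le_of_le_ofReal (by positivity) hlt.le
    calc _ ≤ ε / (‖v‖ + 1) * (‖v‖ + 1) := by gcongr; linarith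
      _ = ε := by field_simp
  ext A hA
  rw [zero_apply, ← enorm_eq_zero]
  refine le_antisymm (le_of_forall_pos_le_add fun ε hε => ?_) zero_le
  rw [zero_add]
  -- Inner regularity passes from compact sets to Borel sets.
  obtain ⟨C, hCA, hC, hlt⟩ := hA.exists_isCompact_sdiff_lt (measure_ne_top η.variation A) hε.ne'
  have h1 : η A = η (A \ C) := by
    have := VectorMeasure.of_add_of_sdiff (v := η) hC.measurableSet hA hCA
    rw [← this, hcomp C hC, zero_add]
  rw [h1]
  exact (VectorMeasure.enorm_measure_le_variation _ _).trans hlt.le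

end Regularity

/-! ### Integration through a Radon–Nikodým density -/

section RadonNikodym

variable {Z E : Type*} [MeasurableSpace Z] [NormedAddCommGroup E] [InnerProductSpace ℂ E]
  [CompleteSpace E] {η : VectorMeasure Z E} {h : Z → E}

/-- The variation of `h d|η|` is `‖h‖ d|η|`; as it is also `|η|`, uniqueness of densities gives `‖h‖
= 1` almost everywhere. -/
theorem IsRadonNikodymDensity.norm_le_one [IsFiniteMeasure η.variation]
    (hh : IsRadonNikodymDensity η h) : ∀ᵐ x ∂η.variation, ‖h x‖ ≤ 1 := by
  have e : η.variation.withDensityᵥ h = η := by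
    ext A hA
    rw [withDensityᵥ_apply hh.integrable hA, hh.apply_eq A hA]
  have e2 : η.variation.withDensity (fun x => ‖h x‖ₑ) = η.variation.withDensity 1 := by
    rw [← Measure.variation_withDensityᵥ hh.integrable, e, withDensity_one]
  have := (withDensity_eq_iff_of_sigmaFinite hh.integrable.1.enorm aemeasurable_const).1 e2
  filter_upwards [this] with x hx
  have hx' : ‖h x‖ₑ = 1 := hx
  rw [← toReal_enorm, hx', ENNReal.toReal_one]

theorem IsRadonNikodymDensity.integrable_inner [IsFiniteMeasure η.variation]
    (hh : IsRadonNikodymDensity η h) {F : Z → E} (hF : Integrable F η.variation) :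
    Integrable (fun x => inner ℂ (h x) (F x)) η.variation := by
  refine hF.norm.mono' (hh.integrable.1.inner hF.1) ?_
  filter_upwards [hh.norm_le_one] with x hx
  exact (norm_inner_le_norm _ _).trans (mul_le_of_le_one_left (norm_nonneg _) hx)

/-- Both sides are additive and bounded by the `L¹` norm, because `‖h‖ ≤ 1`, so it suffices to
compare them on indicators, where the identity defines the density. -/
theorem IsRadonNikodymDensity.bartleIntegral_eq [IsFiniteMeasure η.variation]
    (hh : IsRadonNikodymDensity η h) {F : Z → E} (hF : Integrable F η.variation) :
    bartleIntegral η F = ∫ x, inner ℂ (h x) (F x) ∂η.variation := by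
  rw [← sub_eq_zero]
  refine eq_zero_of_forall_indicator (μ := η.variation) (C := 2)
    (Φ := fun F => bartleIntegral η F - ∫ x, inner ℂ (h x) (F x) ∂η.variation) ?_ ?_ ?_ hF
  · intro F G hF hG
    have h1 : bartleIntegral η (F + G) = bartleIntegral η F + bartleIntegral η G :=
      bartleIntegral_add η hF hG
    simp only [h1, Pi.add_apply, inner_add_right]
    rw [integral_add (hh.integrable_inner hF) (hh.integrable_inner hG)]
    ring
  · intro F hF
    refine (norm_sub_le _ _).trans ?_
    rw [two_mul]
    refine add_le_add (norm_bartleIntegral_le η F) (norm_integral_le_of_norm_le hF.norm ?_)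
    filter_upwards [hh.norm_le_one] with x hx
    exact (norm_inner_le_norm _ _).trans (mul_le_of_le_one_left (norm_nonneg _) hx)
  · intro A v hA _
    have h1 : ∀ x, inner ℂ (h x) (A.indicator (fun _ => v) x) =
        A.indicator (fun x => inner ℂ (h x) v) x := fun x => by
      by_cases hx : x ∈ A <;> simp [hx]
    simp only [h1]
    rw [bartleIntegral_indicator η hA, integral_indicator hA, hh.apply_eq A hA, sub_eq_zero,
      ← inner_conj_symm, ← integral_inner hh.integrable.integrableOn, ← integral_conj]
    simp only [inner_conj_symm]

end RadonNikodym

/-! ### The function `K_η` as a Riesz vector -/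

section Representer

variable {Z E : Type*} [NormedAddCommGroup E] [InnerProductSpace ℂ E] [CompleteSpace E]
  {K : Z → Z → E →L[ℂ] E} [Fact (IsPosSemidefKernel K)]

theorem kerFun_kernelSpace_apply (x y : Z) (v : E) :
    RKHS.kerFun (KernelSpace K) y v x = K x y v := by
  rw [RKHS.kerFun_apply, kernel_kernelSpace]

/-- If every function of the reproducing kernel space is bounded on `S`, then so are the
evaluations, uniformly. -/
theorem exists_norm_apply_le_of_bounded {S : Set Z}
    (hS : ∀ f : KernelSpace K, ∃ r, ∀ x ∈ S, ‖f x‖ ≤ r) :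
    ∃ C, 0 ≤ C ∧ ∀ f : KernelSpace K, ∀ x ∈ S, ‖f x‖ ≤ C * ‖f‖ := by
  -- Evaluation at `x` is the adjoint of `v ↦ K_x v`, hence a continuous operator, and the
  -- hypothesis is pointwise boundedness of this family.
  obtain ⟨C, hC⟩ := banach_steinhaus
    (g := fun x : S => (RKHS.kerFun (KernelSpace K) (x : Z)).adjoint) fun f => by
      obtain ⟨r, hr⟩ := hS f
      exact ⟨r, fun x => by rw [RKHS.adjoint_kerFun]; exact hr x x.2⟩
  -- For empty `S` the constant `C` could be negative.
  refine ⟨max C 0, le_max_right _ _, fun f x hx => ?_⟩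
  rw [← RKHS.adjoint_kerFun]
  exact ContinuousLinearMap.le_of_opNorm_le _ ((hC ⟨x, hx⟩).trans (le_max_left _ _)) f

variable [MeasurableSpace Z]

/-- `k` represents integration against `η` on the reproducing kernel space. -/
def IsRepresenter (η : VectorMeasure Z E) (k : KernelSpace K) : Prop :=
  ∀ f : KernelSpace K, inner ℂ k f = bartleIntegral η f

/-- The uniform bound on evaluations over the conull set `S` makes integration against `η`
continuous for the Hilbert norm. The set `S` is the whole space in the `C₀` case and the compact
support in the other. -/
theorem exists_isRepresenter {η : VectorMeasure Z E} [IsFiniteMeasure η.variation] {S : Set Z}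
    (hSη : ∀ᵐ x ∂η.variation, x ∈ S)
    (hint : ∀ f : KernelSpace K, Integrable f η.variation)
    (hS : ∀ f : KernelSpace K, ∃ r, ∀ x ∈ S, ‖f x‖ ≤ r) :
    ∃ k : KernelSpace K, IsRepresenter η k := by
  obtain ⟨C, hC0, hC⟩ := exists_norm_apply_le_of_bounded hS
  let ℓ : KernelSpace K →L[ℂ] ℂ := LinearMap.mkContinuous
    { toFun f := bartleIntegral η f
      map_add' f g := by
        rw [RKHS.coe_add]
        exact bartleIntegral_add η (hint f) (hint g)
      map_smul' c f := by
        rw [RKHS.coe_smul]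
        exact bartleIntegral_smul η c f }
    (C * η.variation.real Set.univ) fun f => by
      refine (norm_bartleIntegral_le_of_forall_le η (r := C * ‖f‖) ?_ (by positivity)).trans_eq
        (by ring)
      exact hSη.mono fun x hx => hC f x hx
  exact ⟨(InnerProductSpace.toDual ℂ _).symm ℓ, fun f =>
    InnerProductSpace.toDual_symm_apply⟩

namespace IsRepresenter

variable {η : VectorMeasure Z E} {k : KernelSpace K}

theorem inner_apply (hk : IsRepresenter η k) (y : Z) (v : E) :
    inner ℂ (k y) v = bartleIntegral η (fun x => K x y v) := by
  rw [← RKHS.inner_kerFun, hk]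
  congr 1
  exact funext fun x => kerFun_kernelSpace_apply x y v

theorem integrable_kernel (hint : ∀ f : KernelSpace K, Integrable f η.variation) (y : Z) (v : E) :
    Integrable (fun x => K x y v) η.variation :=
  (hint (RKHS.kerFun (KernelSpace K) y v)).congr
    (Eventually.of_forall fun x => kerFun_kernelSpace_apply x y v)

theorem isWeakBochnerIntegrable (hk : IsRepresenter η k)
    (hint : ∀ f : KernelSpace K, Integrable f η.variation) (y : Z) :
    IsWeakBochnerIntegrable η (fun x => K x y) where
  integrable := integrable_kernel hint y
  continuous := by
    simp_rw [← hk.inner_apply]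
    fun_prop

theorem apply_eq (hk : IsRepresenter η k)
    (hint : ∀ f : KernelSpace K, Integrable f η.variation) (y : Z) :
    k y = weakBochnerIntegral η (fun x => K x y) :=
  ext_inner_right ℂ fun v => by
    rw [inner_weakBochnerIntegral (hk.isWeakBochnerIntegrable hint y), hk.inner_apply]

/-- The inner integral is `⟨h(y), K_η(y)⟩` by the reproducing identity. This is the conjugate of the
integrand of `∫ ⟨K_η, dη⟩ = ⟨K_η, K_η⟩`, which is real. No exchange of integrals is needed. -/
theorem inner_eq_integral [IsFiniteMeasure η.variation] (hk : IsRepresenter η k)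
    (hint : ∀ f : KernelSpace K, Integrable f η.variation)
    {h : Z → E} (hh : IsRadonNikodymDensity η h) :
    (∀ y, Integrable (fun x => inner ℂ (h x) (K x y (h y))) η.variation) ∧
      Integrable (fun y => ∫ x, inner ℂ (h x) (K x y (h y)) ∂η.variation) η.variation ∧
      inner ℂ k k = ∫ y, ∫ x, inner ℂ (h x) (K x y (h y)) ∂η.variation ∂η.variation := by
  have h1 : ∀ y, ∫ x, inner ℂ (h x) (K x y (h y)) ∂η.variation = inner ℂ (k y) (h y) := fun y => by
    rw [hk.inner_apply, hh.bartleIntegral_eq (integrable_kernel hint y (h y))]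
  have h2 : ∀ y, inner ℂ (k y) (h y) = starRingEnd ℂ (inner ℂ (h y) (k y)) := fun y =>
    (inner_conj_symm _ _).symm
  have h3 := hh.integrable_inner (hint k)
  refine ⟨fun y => hh.integrable_inner (integrable_kernel hint y (h y)), ?_, ?_⟩
  · simp_rw [h1, h2]
    exact Complex.conjCLE.toContinuousLinearMap.integrable_comp h3
  · simp_rw [h1, h2]
    rw [integral_conj, ← hh.bartleIntegral_eq (hint k), ← hk k, inner_conj_symm]

/-- The properties of the function `K_η` that represents integration against `η`. -/
theorem properties [IsFiniteMeasure η.variation] (hk : IsRepresenter η k)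
    (hint : ∀ f : KernelSpace K, Integrable f η.variation) :
    (∀ y, IsWeakBochnerIntegrable η (fun x => K x y)) ∧
      (∀ y v, inner ℂ (k y) v = bartleIntegral η (fun x => K x y v)) ∧
      (∀ y, k y = weakBochnerIntegral η (fun x => K x y)) ∧
      Integrable (fun y => weakBochnerIntegral η (fun x => K x y)) η.variation ∧
      inner ℂ k k = bartleIntegral η (fun y => weakBochnerIntegral η (fun x => K x y)) ∧
      (∀ h : Z → E, IsRadonNikodymDensity η h →
        (∀ y, Integrable (fun x => inner ℂ (h x) (K x y (h y))) η.variation) ∧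
        Integrable (fun y => ∫ x, inner ℂ (h x) (K x y (h y)) ∂η.variation) η.variation ∧
        inner ℂ k k =
          ∫ y, ∫ x, inner ℂ (h x) (K x y (h y)) ∂η.variation ∂η.variation) := by
  have e : (fun y => weakBochnerIntegral η (fun x => K x y)) = k :=
    funext fun y => (hk.apply_eq hint y).symm
  refine ⟨hk.isWeakBochnerIntegrable hint, hk.inner_apply, hk.apply_eq hint, ?_, ?_,
    fun h hh => hk.inner_eq_integral hint hh⟩
  · rw [e]; exact hint k
  · rw [e]; exact hk k

/-- The vector `k` is zero exactly when the functional it represents is zero. This turns (iii) into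
a question about annihilators. -/
theorem inner_pos_iff (hk : IsRepresenter η k) :
    0 < inner ℂ k k ↔ ∃ f : KernelSpace K, bartleIntegral η f ≠ 0 := by
  have h1 : 0 < inner ℂ k k ↔ k ≠ 0 := by
    rw [inner_self_eq_norm_sq_to_K]
    constructor
    · rintro h rfl
      simp at h
    · intro h
      have h2 : (0 : ℂ) < ((‖k‖ ^ 2 : ℝ) : ℂ) := Complex.zero_lt_real.2 (by positivity)
      rwa [Complex.ofReal_pow] at h2
  rw [h1]
  constructor
  · intro h
    exact ⟨k, by rw [← hk]; simpa using h⟩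
  · rintro ⟨f, hf⟩ rfl
    rw [← hk, inner_zero_left] at hf
    exact hf rfl

end IsRepresenter
end Representer

/-! ### Separation and uniform approximation -/

section Approximation

/-- A point outside the closure of a subspace is separated from it by a functional. -/
theorem exists_dual_ne_zero_of_notMem_closure {V : Type*} [NormedAddCommGroup V] [NormedSpace ℂ V]
    {S : Submodule ℂ V} {g : V} (hg : g ∉ closure (S : Set V)) :
    ∃ L : V →L[ℂ] ℂ, L g ≠ 0 ∧ ∀ s ∈ S, L s = 0 := by
  have hcl : IsClosed (S.topologicalClosure : Set V) := S.isClosed_topologicalClosure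
  have h0 : ‖S.topologicalClosure.mkQL g‖ ≠ 0 := by
    rw [norm_ne_zero_iff]
    intro h
    exact hg ((Submodule.Quotient.mk_eq_zero S.topologicalClosure).1 h)
  obtain ⟨ℓ, -, hℓ⟩ := exists_dual_vector ℂ (S.topologicalClosure.mkQL g) h0
  refine ⟨ℓ.comp S.topologicalClosure.mkQL, ?_, fun s hs => ?_⟩
  · rw [ContinuousLinearMap.comp_apply, hℓ]
    exact Complex.ofReal_ne_zero.2 h0
  · have : S.topologicalClosure.mkQL s = 0 :=
      (Submodule.Quotient.mk_eq_zero S.topologicalClosure).2 (S.le_topologicalClosure hs)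
    rw [ContinuousLinearMap.comp_apply, this, map_zero]

variable {Z E : Type*} [MeasurableSpace Z] [NormedAddCommGroup E] [InnerProductSpace ℂ E]

theorem norm_bartleIntegral_sub_le {η : VectorMeasure Z E} [IsFiniteMeasure η.variation]
    {F G : Z → E} (hF : Integrable F η.variation) (hG : Integrable G η.variation) {ε : ℝ}
    (hε : 0 ≤ ε) (h : ∀ᵐ x ∂η.variation, ‖F x - G x‖ ≤ ε) :
    ‖bartleIntegral η F - bartleIntegral η G‖ ≤ ε * η.variation.real Set.univ := by
  have e : bartleIntegral η (fun x => F x - G x) = bartleIntegral η F - bartleIntegral η G :=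
    VectorMeasure.integral_fun_sub hF hG
  rw [← e]
  exact norm_bartleIntegral_le_of_forall_le η h hε

theorem eq_zero_of_forall_norm_le_mul {z : ℂ} {c : ℝ} (h : ∀ ε > (0 : ℝ), ‖z‖ ≤ ε * c) : z = 0 := by
  rw [← norm_le_zero_iff]
  refine ge_of_tendsto (f := fun ε : ℝ => ε * c) (x := 𝓝[>] 0) ?_
    (eventually_nhdsWithin_of_forall h)
  have : Tendsto (fun ε : ℝ => ε * c) (𝓝 0) (𝓝 (0 * c)) := tendsto_id.mul_const c
  rw [zero_mul] at this
  exact this.mono_left nhdsWithin_le_nhds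

theorem bartleIntegral_eq_zero_of_approx {η : VectorMeasure Z E} [IsFiniteMeasure η.variation]
    {G : Z → E} (hG : Integrable G η.variation)
    (h : ∀ ε > (0 : ℝ), ∃ F, Integrable F η.variation ∧ bartleIntegral η F = 0 ∧
      ∀ᵐ x ∂η.variation, ‖F x - G x‖ ≤ ε) : bartleIntegral η G = 0 := by
  refine eq_zero_of_forall_norm_le_mul (c := η.variation.real Set.univ) fun ε hε => ?_
  obtain ⟨F, hF, h0, hFG⟩ := h ε hε
  have := norm_bartleIntegral_sub_le hF hG hε.le hFG
  rwa [h0, zero_sub, norm_neg] at this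

end Approximation

/-! ### Duality and density in `C₀(Z, E)` -/

section VanishingAtInfinity

open scoped ZeroAtInfty

variable {Z E : Type*} [TopologicalSpace Z] [T2Space Z] [LocallyCompactSpace Z]
  [NormedAddCommGroup E] [InnerProductSpace ℂ E]

/-- The inclusion of the compactly supported functions into the functions that vanish at
infinity. -/
noncomputable def toZeroAtInfty (Z E : Type*) [TopologicalSpace Z] [NormedAddCommGroup E]
    [InnerProductSpace ℂ E] : C_c(Z, E) →ₗ[ℂ] C₀(Z, E) where
  toFun g := ⟨⟨g, g.continuous⟩, g.hasCompactSupport.is_zero_at_infty⟩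
  map_add' _ _ := rfl
  map_smul' _ _ := rfl

theorem norm_zeroAtInfty_le {Z E : Type*} [TopologicalSpace Z] [NormedAddCommGroup E]
    {g : C₀(Z, E)} {r : ℝ} (h0 : 0 ≤ r) (h : ∀ x, ‖g x‖ ≤ r) : ‖g‖ ≤ r := by
  rw [← ZeroAtInftyContinuousMap.norm_toBCF_eq_norm]
  exact (BoundedContinuousFunction.norm_le h0).2 h

theorem norm_apply_le_norm_zeroAtInfty {Z E : Type*} [TopologicalSpace Z]
    [NormedAddCommGroup E] (g : C₀(Z, E)) (x : Z) : ‖g x‖ ≤ ‖g‖ := by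
  rw [← ZeroAtInftyContinuousMap.norm_toBCF_eq_norm]
  exact g.toBCF.norm_coe_le_norm x

/-- The compactly supported functions are dense in the functions that vanish at infinity. -/
theorem exists_compactlySupported_approx (g : C₀(Z, E)) {ε : ℝ} (hε : 0 < ε) :
    ∃ f : C_c(Z, E), ∀ x, ‖f x - g x‖ ≤ ε := by
  have hev : ∀ᶠ x in cocompact Z, ‖g x‖ < ε := by
    have := (tendsto_zero_iff_norm_tendsto_zero.1 g.zero_at_infty')
    exact this.eventually (gt_mem_nhds hε)
  obtain ⟨C, hC, hCs⟩ := mem_cocompact.1 hev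
  obtain ⟨χ, h1, -, hc, h01⟩ := exists_continuous_one_zero_of_isCompact hC
    (isClosed_empty (X := Z)) (Set.disjoint_empty _)
  refine ⟨⟨⟨fun x => χ x • g x, by have := g.continuous; fun_prop⟩, hc.smul_right⟩, fun x => ?_⟩
  change ‖χ x • g x - g x‖ ≤ ε
  by_cases hx : x ∈ C
  · simp [h1 hx, hε.le]
  · have h2 : ‖g x‖ < ε := hCs hx
    have e : χ x • g x - g x = -((1 - χ x) • g x) := by rw [sub_smul, one_smul]; abel
    rw [e, norm_neg, norm_smul, Real.norm_of_nonneg (sub_nonneg.2 (h01 x).2)]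
    refine (mul_le_of_le_one_left (norm_nonneg _) ?_).trans h2.le
    linarith [(h01 x).1]

variable [MeasurableSpace Z] [BorelSpace Z]

theorem integrable_zeroAtInfty {Z E : Type*} [TopologicalSpace Z] [T2Space Z] [MeasurableSpace Z]
    [BorelSpace Z] [NormedAddCommGroup E] {μ : Measure Z} [IsFiniteMeasure μ] [μ.Regular]
    (g : C₀(Z, E)) :
    Integrable g μ :=
  integrable_of_continuous g.continuous
    (Eventually.of_forall fun x => norm_apply_le_norm_zeroAtInfty g x)

variable [CompleteSpace E]

/-- The dual of the space of functions that vanish at infinity consists of the regular vector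
measures of bounded variation. -/
theorem exists_isRadonBV_of_dual_zeroAtInfty (L : C₀(Z, E) →L[ℂ] ℂ) :
    ∃ η : VectorMeasure Z E, IsRadonBV η ∧ ∀ g : C₀(Z, E), L g = bartleIntegral η g := by
  have hL : IsSupBounded (L.toLinearMap ∘ₗ toZeroAtInfty Z E) ‖L‖₊ := fun g r hr =>
    (L.le_opNNNorm _).trans <| by
      gcongr
      exact norm_zeroAtInfty_le r.2 fun x => hr x
  obtain ⟨η, hη, hLη⟩ := hL.exists_vectorMeasure
  have := hη.finite
  have := hη.regular
  -- The representation is known on compactly supported functions; both sides are continuous for the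
  -- supremum norm, so it extends by density.
  refine ⟨η, hη, fun g => sub_eq_zero.1 <|
    eq_zero_of_forall_norm_le_mul (c := ‖L‖ + η.variation.real Set.univ) fun ε hε => ?_⟩
  obtain ⟨f, hf⟩ := exists_compactlySupported_approx g hε
  have h1 : ‖L g - L (toZeroAtInfty Z E f)‖ ≤ ‖L‖ * ε := by
    rw [← map_sub]
    refine L.le_opNorm_of_le (norm_zeroAtInfty_le hε.le fun x => ?_)
    rw [← norm_neg, ZeroAtInftyContinuousMap.sub_apply, neg_sub]
    exact hf x
  have h2 := norm_bartleIntegral_sub_le (integrable_of_compactlySupported η.variation f)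
    (integrable_zeroAtInfty g) hε.le (Eventually.of_forall hf)
  have h3 : L (toZeroAtInfty Z E f) = bartleIntegral η f := hLη f
  calc ‖L g - bartleIntegral η g‖
      = ‖(L g - L (toZeroAtInfty Z E f)) + (bartleIntegral η f - bartleIntegral η g)‖ := by
        rw [h3]; congr 1; ring
    _ ≤ ‖L‖ * ε + ε * η.variation.real Set.univ := (norm_add_le _ _).trans (add_le_add h1 h2)
    _ = _ := by ring

variable {K : Z → Z → E →L[ℂ] E} [Fact (IsPosSemidefKernel K)]

/-- By density an annihilating `η` kills every compactly supported Urysohn function times a vector,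
and these determine a regular measure. -/
theorem IsC₀Universal.eq_zero (hK : IsC₀Universal K) {η : VectorMeasure Z E} (hη : IsRadonBV η)
    (h : ∀ f : KernelSpace K, bartleIntegral η f = 0) : η = 0 := by
  have := hη.finite
  have := hη.regular
  refine hη.eq_zero_of_separating fun C U hC hU hCU v => ?_
  obtain ⟨φ, h1, h0, hc, h01⟩ := exists_continuous_one_zero_of_isCompact hC hU.isClosed_compl
    (Set.disjoint_compl_right_iff_subset.2 hCU)
  let g : C_c(Z, E) := ⟨⟨fun x => φ x • v, by fun_prop⟩, hc.smul_right⟩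
  refine ⟨φ, aestronglyMeasurable_of_continuous φ.continuous, h01,
    Eventually.of_forall fun x hx => h1 hx, Eventually.of_forall fun x hx => h0 hx, ?_⟩
  refine bartleIntegral_eq_zero_of_approx (integrable_of_compactlySupported η.variation g)
    fun ε hε => ?_
  obtain ⟨f, hf⟩ := hK.2 (toZeroAtInfty Z E g) ε hε
  obtain ⟨f', hf'⟩ := hK.1 f
  refine ⟨f, ?_, h f, Eventually.of_forall fun x => (hf x).le⟩
  rw [← funext hf']
  exact integrable_zeroAtInfty f'

/-- If the space were not dense, Hahn–Banach would give a nonzero functional that annihilates it,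
and the Riesz theorem would turn this functional into a forbidden measure. -/
theorem isC₀Universal_of_forall (hK : SubsetC₀ K)
    (h : ∀ η : VectorMeasure Z E, IsRadonBV η → η ≠ 0 →
      ∃ f : KernelSpace K, bartleIntegral η f ≠ 0) : IsC₀Universal K := by
  refine ⟨hK, ?_⟩
  let S : Submodule ℂ C₀(Z, E) :=
    { carrier := {g | ∃ f : KernelSpace K, ∀ x, g x = f x}
      add_mem' := by
        rintro g g' ⟨f, hf⟩ ⟨f', hf'⟩
        exact ⟨f + f', fun x => by simp [hf, hf']⟩
      zero_mem' := ⟨0, fun x => by simp⟩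
      smul_mem' := by
        rintro c g ⟨f, hf⟩
        exact ⟨c • f, fun x => by simp [hf]⟩ }
  intro g ε hε
  have hg : g ∈ closure (S : Set C₀(Z, E)) := by
    by_contra hg
    obtain ⟨L, hLg, hLS⟩ := exists_dual_ne_zero_of_notMem_closure hg
    obtain ⟨η, hη, hLη⟩ := exists_isRadonBV_of_dual_zeroAtInfty L
    have hη0 : η ≠ 0 := by
      rintro rfl
      refine hLg ((hLη g).trans ?_)
      exact VectorMeasure.integral_zero_vectorMeasure
    obtain ⟨f, hf⟩ := h η hη hη0
    obtain ⟨f', hf'⟩ := hK f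
    refine hf ?_
    rw [← funext hf', ← hLη]
    exact hLS f' ⟨f, hf'⟩
  obtain ⟨g', ⟨f, hf⟩, hd⟩ := Metric.mem_closure_iff.1 hg ε hε
  refine ⟨f, fun x => ?_⟩
  rw [← hf, ← norm_neg, neg_sub]
  rw [dist_eq_norm] at hd
  exact (norm_apply_le_norm_zeroAtInfty (g - g') x).trans_lt hd

end VanishingAtInfinity

/-! ### Duality and density on compact sets -/

section Compact

variable {Z E : Type*} [TopologicalSpace Z] [T2Space Z] [MeasurableSpace Z] [BorelSpace Z]
  [NormedAddCommGroup E] [InnerProductSpace ℂ E]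

/-- The inclusion of the compactly supported functions into the continuous functions. -/
def toContinuousMapLinear (X E : Type*) [TopologicalSpace X] [NormedAddCommGroup E]
    [InnerProductSpace ℂ E] : C_c(X, E) →ₗ[ℂ] C(X, E) where
  toFun g := g.toContinuousMap
  map_add' _ _ := rfl
  map_smul' _ _ := rfl

/-- The dual of the space of continuous functions on a compact space consists of the regular
vector measures of bounded variation. -/
theorem exists_isRadonBV_of_dual_continuousMap {X : Type*} [TopologicalSpace X] [T2Space X]
    [CompactSpace X] [MeasurableSpace X] [BorelSpace X] [CompleteSpace E] (L : C(X, E) →L[ℂ] ℂ) :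
    ∃ η : VectorMeasure X E, IsRadonBV η ∧ ∀ g : C(X, E), L g = bartleIntegral η g := by
  have hL : IsSupBounded (L.toLinearMap ∘ₗ toContinuousMapLinear X E) ‖L‖₊ := fun g r hr =>
    (L.le_opNNNorm _).trans <| by
      gcongr
      exact (ContinuousMap.norm_le _ r.2).2 fun x => hr x
  obtain ⟨η, hη, hLη⟩ := hL.exists_vectorMeasure
  exact ⟨η, hη, fun g => hLη ⟨g, HasCompactSupport.of_compactSpace g⟩⟩

/-- Variation commutes with push-forward along the measurable embedding of `A`. This carries the
measures given by duality on `A` to admissible measures on `Z`. -/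
theorem IsRadonBV.map_subtype_val {Z E : Type*} [TopologicalSpace Z] [T2Space Z]
    [MeasurableSpace Z] [BorelSpace Z] [NormedAddCommGroup E] {A : Set Z} (hA : IsCompact A)
    {η : VectorMeasure A E}
    (hη : IsRadonBV η) : IsRadonBV (η.map (Subtype.val : A → Z)) ∧
      HasCompactSupp (η.map (Subtype.val : A → Z)) := by
  have := hη.finite
  have := hη.regular
  have hvar : (η.map (Subtype.val : A → Z)).variation = η.variation.map Subtype.val :=
    (MeasurableEmbedding.subtype_coe hA.measurableSet).variation_map
  have hin : (η.variation.map (Subtype.val : A → Z)).InnerRegularCompactLTTop :=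
    .map_of_continuous continuous_subtype_val
  refine ⟨⟨?_, ?_⟩, ?_⟩
  · rw [hvar]; infer_instance
  · rw [hvar]; infer_instance
  · rw [HasCompactSupp, hvar]
    refine hA.of_isClosed_subset Measure.isClosed_support
      (Measure.support_subset_of_isClosed hA.isClosed ?_)
    rw [mem_ae_iff, Measure.map_apply measurable_subtype_coe hA.measurableSet.compl]
    simp

variable [CompleteSpace E] {K : Z → Z → E →L[ℂ] E} [Fact (IsPosSemidefKernel K)]

/-- A continuous function is bounded on the compact support, and regularity makes the support
conull. -/
theorem integrable_kernelSpace (hK : SubsetC K) {η : VectorMeasure Z E} (hη : IsRadonBV η)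
    (hηc : HasCompactSupp η) (f : KernelSpace K) : Integrable f η.variation := by
  have := hη.finite
  have := hη.regular
  obtain ⟨r, hr⟩ := hηc.exists_bound_of_continuousOn (hK f).continuousOn
  exact integrable_of_continuous (hK f) (mem_of_superset Measure.support_mem_ae_of_regular hr)

/-- Here `Z` need not be locally compact, so the Urysohn function is built on the compact support of
`η` and extended by zero. The extension is only measurable on `Z`, which is all that
`IsRadonBV.eq_zero_of_separating` requires. -/
theorem IsUniversal.eq_zero (hK : IsUniversal K) {η : VectorMeasure Z E} (hη : IsRadonBV η)
    (hηc : HasCompactSupp η) (h : ∀ f : KernelSpace K, bartleIntegral η f = 0) : η = 0 := by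
  have := hη.finite
  have := hη.regular
  have hS : ∀ᵐ x ∂η.variation, x ∈ η.variation.support := Measure.support_mem_ae_of_regular
  set A := η.variation.support with hA
  have : CompactSpace A := isCompact_iff_compactSpace.1 hηc
  have hval : Continuous (Subtype.val : A → Z) := continuous_subtype_val
  refine hη.eq_zero_of_separating fun C U hC hU hCU v => ?_
  obtain ⟨φ, h0, h1, h01⟩ := exists_continuous_zero_one_of_isClosed
    (hU.isClosed_compl.preimage hval) (hC.isClosed.preimage hval)
    (Disjoint.preimage _ (Set.disjoint_compl_left_iff_subset.2 hCU))
  set ψ : Z → ℝ := Function.extend Subtype.val φ 0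
  have hψ : ∀ x : A, ψ x = φ x := fun x => Subtype.val_injective.extend_apply _ _ x
  have hψm : Measurable ψ :=
    (MeasurableEmbedding.subtype_coe hηc.measurableSet).measurable_extend
      φ.continuous.measurable measurable_const
  have hψ01 : ∀ x, ψ x ∈ Set.Icc (0 : ℝ) 1 := fun x => by
    by_cases hx : x ∈ A
    · rw [hψ ⟨x, hx⟩]
      exact h01 _
    · have h0 : ψ x = 0 := Function.extend_apply' _ _ _ fun ⟨a, ha⟩ => hx (ha ▸ a.2)
      simp [h0]
  refine ⟨ψ, hψm.aestronglyMeasurable, hψ01, ?_, ?_, ?_⟩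
  · filter_upwards [hS] with x hx hxC
    rw [hψ ⟨x, hx⟩]
    exact h1 hxC
  · filter_upwards [hS] with x hx hxU
    rw [hψ ⟨x, hx⟩]
    exact h0 hxU
  · refine bartleIntegral_eq_zero_of_approx ?_ fun ε hε => ?_
    · refine (Integrable.of_bound hψm.aestronglyMeasurable 1
        (Eventually.of_forall fun x => ?_)).smul_const v
      rw [Real.norm_of_nonneg (hψ01 x).1]
      exact (hψ01 x).2
    · obtain ⟨f, hf⟩ := hK.2 A hηc ⟨fun x => φ x • v, by fun_prop⟩ ε hε
      refine ⟨f, integrable_kernelSpace hK.1 hη hηc f, h f, ?_⟩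
      filter_upwards [hS] with x hx
      rw [hψ ⟨x, hx⟩]
      exact (hf ⟨x, hx⟩).le

/-- The Hahn–Banach argument is run in `C(A, E)`, and the annihilating measure on `A` is pushed
forward to `Z`. -/
theorem isUniversal_of_forall (hK : SubsetC K)
    (h : ∀ η : VectorMeasure Z E, IsRadonBV η → HasCompactSupp η → η ≠ 0 →
      ∃ f : KernelSpace K, bartleIntegral η f ≠ 0) : IsUniversal K := by
  refine ⟨hK, fun A hA g ε hε => ?_⟩
  have : CompactSpace A := isCompact_iff_compactSpace.1 hA
  let res : KernelSpace K → C(A, E) := fun f => ⟨fun x => f x, (hK f).comp continuous_subtype_val⟩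
  let S : Submodule ℂ C(A, E) :=
    { carrier := Set.range res
      add_mem' := by
        rintro _ _ ⟨f, rfl⟩ ⟨f', rfl⟩
        exact ⟨f + f', by ext x; simp [res]⟩
      zero_mem' := ⟨0, by ext x; simp [res]⟩
      smul_mem' := by
        rintro c _ ⟨f, rfl⟩
        exact ⟨c • f, by ext x; simp [res]⟩ }
  have hg : g ∈ closure (S : Set C(A, E)) := by
    by_contra hg
    obtain ⟨L, hLg, hLS⟩ := exists_dual_ne_zero_of_notMem_closure hg
    obtain ⟨η, hη, hLη⟩ := exists_isRadonBV_of_dual_continuousMap L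
    obtain ⟨hη', hηc⟩ := hη.map_subtype_val hA
    have hint : ∀ F : Z → E, bartleIntegral (η.map (Subtype.val : A → Z)) F =
        bartleIntegral η (F ∘ Subtype.val) := fun F =>
      (MeasurableEmbedding.subtype_coe hA.measurableSet).integral_map_vectorMeasure
    have hη0 : η.map (Subtype.val : A → Z) ≠ 0 := by
      intro h0
      -- The push-forward loses nothing: if its variation is zero, then so is the variation of `η`.
      have hv := (MeasurableEmbedding.subtype_coe hA.measurableSet).variation_map (μ := η)
      rw [h0, VectorMeasure.variation_zero] at hv
      have : η = 0 := by
        rw [← VectorMeasure.variation_eq_zero]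
        exact (Measure.map_eq_zero_iff measurable_subtype_coe.aemeasurable).1 hv.symm
      subst this
      refine hLg ((hLη g).trans ?_)
      exact VectorMeasure.integral_zero_vectorMeasure
    obtain ⟨f, hf⟩ := h _ hη' hηc hη0
    refine hf ?_
    rw [hint]
    exact (hLη (res f)).symm.trans (hLS _ ⟨f, rfl⟩)
  obtain ⟨_, ⟨f, rfl⟩, hd⟩ := Metric.mem_closure_iff.1 hg ε hε
  refine ⟨f, fun x => ?_⟩
  rw [← norm_neg, neg_sub]
  rw [dist_eq_norm] at hd
  exact ((g - res f).norm_coe_le_norm x).trans_lt hd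

end Compact

end OpKernel

/-! ### The main theorem -/

open OpKernel in
theorem mainTheorem1 {Z E : Type*} [TopologicalSpace Z] [T2Space Z] [MeasurableSpace Z]
    [BorelSpace Z] [NormedAddCommGroup E] [InnerProductSpace ℂ E] [CompleteSpace E]
    (K : Z → Z → E →L[ℂ] E) [Fact (IsPosSemidefKernel K)] :
    -- the `C₀` case
    (LocallyCompactSpace Z → SubsetC₀ K →
      ∃ Kη : VectorMeasure Z E → KernelSpace K,
        (∀ η : VectorMeasure Z E, IsRadonBV η →
          -- (i)
          (∀ y, IsWeakBochnerIntegrable η (fun x => K x y)) ∧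
          (∀ y v, inner ℂ (Kη η y) v = bartleIntegral η (fun x => K x y v)) ∧
          (∀ y, Kη η y = weakBochnerIntegral η (fun x => K x y)) ∧
          -- (ii)
          Integrable (fun y => weakBochnerIntegral η (fun x => K x y)) η.variation ∧
          inner ℂ (Kη η) (Kη η) =
            bartleIntegral η (fun y => weakBochnerIntegral η (fun x => K x y)) ∧
          (∀ h : Z → E, IsRadonNikodymDensity η h →
            (∀ y, Integrable (fun x => inner ℂ (h x) (K x y (h y))) η.variation) ∧
            Integrable (fun y => ∫ x, inner ℂ (h x) (K x y (h y)) ∂η.variation) η.variation ∧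
            inner ℂ (Kη η) (Kη η) =
              ∫ y, ∫ x, inner ℂ (h x) (K x y (h y)) ∂η.variation ∂η.variation)) ∧
        -- (iii)
        (IsC₀Universal K ↔
          ∀ η : VectorMeasure Z E, IsRadonBV η → η ≠ 0 → 0 < inner ℂ (Kη η) (Kη η))) ∧
    -- the `C` case
    (SubsetC K →
      ∃ Kη : VectorMeasure Z E → KernelSpace K,
        (∀ η : VectorMeasure Z E, IsRadonBV η → HasCompactSupp η →
          -- (i)
          (∀ y, IsWeakBochnerIntegrable η (fun x => K x y)) ∧
          (∀ y v, inner ℂ (Kη η y) v = bartleIntegral η (fun x => K x y v)) ∧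
          (∀ y, Kη η y = weakBochnerIntegral η (fun x => K x y)) ∧
          -- (ii)
          Integrable (fun y => weakBochnerIntegral η (fun x => K x y)) η.variation ∧
          inner ℂ (Kη η) (Kη η) =
            bartleIntegral η (fun y => weakBochnerIntegral η (fun x => K x y)) ∧
          (∀ h : Z → E, IsRadonNikodymDensity η h →
            (∀ y, Integrable (fun x => inner ℂ (h x) (K x y (h y))) η.variation) ∧
            Integrable (fun y => ∫ x, inner ℂ (h x) (K x y (h y)) ∂η.variation) η.variation ∧
            inner ℂ (Kη η) (Kη η) =
              ∫ y, ∫ x, inner ℂ (h x) (K x y (h y)) ∂η.variation ∂η.variation)) ∧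
        -- (iii)
        (IsUniversal K ↔
          ∀ η : VectorMeasure Z E, IsRadonBV η → HasCompactSupp η → η ≠ 0 →
            0 < inner ℂ (Kη η) (Kη η))) := by
  classical
  constructor
  · intro hZ hK
    have hint : ∀ η : VectorMeasure Z E, IsRadonBV η → ∀ f : KernelSpace K,
        Integrable f η.variation := fun η hη f => by
      have := hη.finite
      have := hη.regular
      obtain ⟨g, hg⟩ := hK f
      rw [← funext hg]
      exact integrable_zeroAtInfty g
    -- `Kη` is a total function on vector measures; outside the admissible ones it takes the default
    -- value `0`.
    have hex : ∀ η : VectorMeasure Z E, ∃ k : KernelSpace K, IsRadonBV η → IsRepresenter η k := by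
      intro η
      by_cases hη : IsRadonBV η
      · have := hη.finite
        obtain ⟨k, hk⟩ := exists_isRepresenter (S := Set.univ) (by simp) (hint η hη) fun f => by
          obtain ⟨g, hg⟩ := hK f
          exact ⟨‖g‖, fun x _ => by rw [← hg]; exact norm_apply_le_norm_zeroAtInfty g x⟩
        exact ⟨k, fun _ => hk⟩
      · exact ⟨0, fun h => absurd h hη⟩
    choose Kη hKη using hex
    refine ⟨Kη, fun η hη => ?_, fun h η hη hη0 => ?_, fun h => ?_⟩
    · have := hη.finite
      exact (hKη η hη).properties (hint η hη)
    · rw [(hKη η hη).inner_pos_iff]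
      by_contra! h0
      exact hη0 (h.eq_zero hη h0)
    · exact isC₀Universal_of_forall hK fun η hη hη0 => (hKη η hη).inner_pos_iff.1 (h η hη hη0)
  · intro hK
    have hex : ∀ η : VectorMeasure Z E, ∃ k : KernelSpace K,
        IsRadonBV η → HasCompactSupp η → IsRepresenter η k := by
      intro η
      by_cases hη : IsRadonBV η ∧ HasCompactSupp η
      · have := hη.1.finite
        have := hη.1.regular
        obtain ⟨k, hk⟩ := exists_isRepresenter (S := η.variation.support)
          Measure.support_mem_ae_of_regular (integrable_kernelSpace hK hη.1 hη.2)
          fun f => hη.2.exists_bound_of_continuousOn (hK f).continuousOn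
        exact ⟨k, fun _ _ => hk⟩
      · exact ⟨0, fun h h' => absurd ⟨h, h'⟩ hη⟩
    choose Kη hKη using hex
    refine ⟨Kη, fun η hη hηc => ?_, fun h η hη hηc hη0 => ?_, fun h => ?_⟩
    · have := hη.finite
      exact (hKη η hη hηc).properties (integrable_kernelSpace hK hη hηc)
    · rw [(hKη η hη hηc).inner_pos_iff]
      by_contra! h0
      exact hη0 (h.eq_zero hη hηc h0)
    · exact isUniversal_of_forall hK fun η hη hηc hη0 =>
        (hKη η hη hηc).inner_pos_iff.1 (h η hη hηc hη0)
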